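/- Let $\{S_i\}_{i\in I}$ be a finite family of similarities $S_i(x)=r_ix+d_i$ of $\mathbb R$ with $0<|r_i|<1$, and let $K$ be its self-similar set (the non-empty compact set with $K=\bigcup_i S_i(K)$), normalized so that the convex hull of $K$ is $[0,1]$ (in particular $K$ is not a singleton). For a finite word $\sigma=(i_1,\dots,i_n)$ put $S_\sigma=S_{i_1}\circ\cdots\circ S_{i_n}$, $r_\sigma=r_{i_1}\cdots r_{i_n}$ and $\sigma^-=(i_1,\dots,i_{n-1})$; for $t>0$ let $\Lambda_t=\{\sigma:|r_\sigma|<t\le |r_{\sigma^-}|\}$ (with $|r_{\sigma^-}|=\infty$ for the empty word $\sigma$). Assume the weak separation condition $$\sup_{x\in\mathbb R,\,t>0}\#\{S_\sigma:\sigma\in\Lambda_t,\ S_\sigma(K)\cap U(x,t)\ne\emptyset\}<\infty,\qquad(\ast)$$ where $U(x,t)$ is the open ball of centre $x$ and radius $t$. A net interval of generation $t$ is an interval $\Delta=[h,h']$ with $(h,h')\cap K\neq\emptyset$, where $h<h'$ are consecutive elements of $\{S_\sigma(0),S_\sigma(1):\sigma\in\Lambda_t\}$; it is always considered together with its generation.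 With $T_\Delta(x)=(h'-h)x+h$, its neighbour set is $\mathcal V(\Delta)=\{T_\Delta^{-1}\circ S_\sigma:\sigma\in\Lambda_t,\ S_\sigma(K)\cap(h,h')\ne\emptyset\}$; its children are the net intervals contained in $\Delta$ of generation $\max\{|r_\sigma|:\sigma\in\Lambda_t,\ S_\sigma(K)\cap (h,h')\neq\emptyset\}$. The transition graph has as vertices the neighbour sets of all net intervals of all generations $t>0$, and an edge $(\mathcal V(\Delta),\mathcal V(\Delta'),q)$ for each child $\Delta'$ of a net interval $\Delta$, where $q$ is the distance between the left ends of $\Delta$ and $\Delta'$ divided by $\operatorname{diam}\Delta$. An essential class is a non-empty induced subgraph in which any vertex can be reached by a path from any vertex and which contains every vertex that can be reached by a path from one of its vertices. A symbolic representation of $x\in K$ is the infinite path of edges given by a sequence $(\Delta_n)_{n\geq 0}$, where $\Delta_0=[0,1]$ is the net interval of generation $>1$, each $\Delta_{n+1}$ is a child of $\Delta_n$, and $\bigcap_n\Delta_n=\{x\}$. Then the transition graph has exactly one essential class $\mathcal G_{\mathrm{ess}}$. Call a net interval essential if its neighbour set is a vertex of $\mathcal G_{\mathrm{ess}}$, and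 let $K_{\mathrm{ess}}$ be the set of $x\in K$ such that every symbolic representation of $x$ has all but finitely many of its edges in $\mathcal G_{\mathrm{ess}}$. The following hold. (i) Let $U_0$ be an open ball that attains the supremum in $(\ast)$. Then $S_\sigma(U_0)$ also attains it for every finite word $\sigma$, and $K\cap U_0$ is contained in a finite union of essential net intervals; in particular $K\cap U_0\subseteq K_{\mathrm{ess}}$. (ii) Let $\mu$ be a self-similar measure, that is, the Borel probability measure with support $K$ and $\mu(E)=\sum_i p_i\,\mu(S_i^{-1}(E))$ for all Borel sets $E$, where $p_i>0$ and $\sum_ip_i=1$. Then for every vertex $v$ of $\mathcal G_{\mathrm{ess}}$, $$\mu\Bigl(K\setminus\bigcup_{\Delta:\,\mathcal V(\Delta)=v}(\Delta\cap K)\Bigr)=0,$$ and in particular $\mu(K\setminus K_{\mathrm{ess}})=0$. -/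

import Mathlib

/-- A finite family of contracting similarities `x ↦ r i * x + d i` of the real line, with
`0 < |r i| < 1` (negative ratios are allowed). -/
structure IFS (I : Type*) where
  r : I → ℝ
  d : I → ℝ
  r_pos : ∀ i, 0 < |r i|
  r_lt_one : ∀ i, |r i| < 1

/-- A closed interval `[left, right]` tagged with a generation `gen`. -/
@[ext] structure GenInterval where
  gen : ℝ
  left : ℝ
  right : ℝ

/-- A labelled directed edge between neighbour sets. -/
@[ext] structure NbEdge where
  source : Set (ℝ → ℝ)
  target : Set (ℝ → ℝ)
  label : ℝ

namespace GenInterval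

/-- The underlying closed interval `Δ`. -/
def toSet (Δ : GenInterval) : Set ℝ := Set.Icc Δ.left Δ.right

/-- The interior of `Δ`. -/
def inner (Δ : GenInterval) : Set ℝ := Set.Ioo Δ.left Δ.right

noncomputable section

/-- The inverse of the increasing affine map `T_Δ` of `[0,1]` onto `Δ`, where
`T_Δ x = (right - left) * x + left`. -/
def Tinv (Δ : GenInterval) (x : ℝ) : ℝ := (x - Δ.left) / (Δ.right - Δ.left)

end

end GenInterval

namespace IFS

noncomputable section

variable {I : Type*}

/-- The similarity `S_i`. -/
def fn (S : IFS I) (i : I) (x : ℝ) : ℝ := S.r i * x + S.d i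

/-- `S_σ = S_{i₁} ∘ ⋯ ∘ S_{iₙ}` for a finite word `σ = (i₁, …, iₙ)`. -/
def wordMap (S : IFS I) : List I → ℝ → ℝ
  | [] => id
  | i :: σ => S.fn i ∘ S.wordMap σ

/-- `r_σ = r_{i₁} ⋯ r_{iₙ}`. -/
def ratio (S : IFS I) (σ : List I) : ℝ := (σ.map S.r).prod

/-- `K` is the self-similar set of the IFS. -/
structure IsAttractor (S : IFS I) (K : Set ℝ) : Prop where
  nonempty : K.Nonempty
  isCompact : IsCompact K
  eq_iUnion : K = ⋃ i, S.fn i '' K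

/-- The words of generation `t`: `|r_σ| < t ≤ |r_{σ⁻}|`, where `σ⁻` drops the last letter.
For the empty word the upper bound is void (`r_{σ⁻}` counts as infinite), so that it is the
only word of generation `t` when `t > 1`. -/
def words (S : IFS I) (t : ℝ) : Set (List I) :=
  {σ | |S.ratio σ| < t ∧ (σ ≠ [] → t ≤ |S.ratio σ.dropLast|)}

/-- The set of maps `S_σ` with `σ` of generation `t` such that `S_σ(K)` meets `E`. -/
def mapsMeeting (S : IFS I) (K : Set ℝ) (t : ℝ) (E : Set ℝ) : Set (ℝ → ℝ) :=
  {f | ∃ σ ∈ S.words t, (S.wordMap σ '' K ∩ E).Nonempty ∧ f = S.wordMap σ}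

/-- The supremum over all `x` and all `t > 0` of the number of distinct maps `S_σ`, with `σ` of
generation `t`, such that `S_σ(K)` meets the open ball `U(x,t)`. -/
def wscSup (S : IFS I) (K : Set ℝ) : ℕ∞ :=
  ⨆ (x : ℝ) (t : ℝ) (_ : 0 < t), (S.mapsMeeting K t (Metric.ball x t)).encard

/-- The weak separation condition. -/
def WeakSeparation (S : IFS I) (K : Set ℝ) : Prop := S.wscSup K < ⊤

/-- `U` is an open ball which attains the supremum in the weak separation condition. -/
def AttainsWscSup (S : IFS I) (K U : Set ℝ) : Prop :=
  ∃ x t : ℝ, 0 < t ∧ U = Metric.ball x t ∧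
    (S.mapsMeeting K t (Metric.ball x t)).encard = S.wscSup K

/-- The endpoints of generation `t`. -/
def endpoints (S : IFS I) (t : ℝ) : Set ℝ :=
  {h | ∃ σ ∈ S.words t, h = S.wordMap σ 0 ∨ h = S.wordMap σ 1}

/-- `Δ` is a net interval of generation `Δ.gen`: its ends are consecutive endpoints of that
generation, and its interior meets `K`. -/
structure IsNetInterval (S : IFS I) (K : Set ℝ) (Δ : GenInterval) : Prop where
  gen_pos : 0 < Δ.gen
  lt : Δ.left < Δ.right
  left_mem : Δ.left ∈ S.endpoints Δ.gen
  right_mem : Δ.right ∈ S.endpoints Δ.gen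
  consecutive : ∀ h ∈ S.endpoints Δ.gen, h ∉ Δ.inner
  meets : (Δ.inner ∩ K).Nonempty

/-- The words of the generation of `Δ` which generate a neighbour of `Δ`. -/
def genWords (S : IFS I) (K : Set ℝ) (Δ : GenInterval) : Set (List I) :=
  {σ | σ ∈ S.words Δ.gen ∧ (S.wordMap σ '' K ∩ Δ.inner).Nonempty}

/-- The neighbour set of `Δ` (in its generation). -/
def nbSet (S : IFS I) (K : Set ℝ) (Δ : GenInterval) : Set (ℝ → ℝ) :=
  {f | ∃ σ ∈ S.genWords K Δ, f = Δ.Tinv ∘ S.wordMap σ}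

/-- The transition generation of `Δ`: the largest `|r_σ|` among the words generating neighbours. -/
def tg (S : IFS I) (K : Set ℝ) (Δ : GenInterval) : ℝ :=
  sSup ((fun σ => |S.ratio σ|) '' S.genWords K Δ)

/-- `Δ'` is a child of `Δ`: a net interval of generation `tg(Δ)` contained in `Δ`. -/
structure IsChild (S : IFS I) (K : Set ℝ) (Δ Δ' : GenInterval) : Prop where
  isNetInterval : S.IsNetInterval K Δ'
  gen_eq : Δ'.gen = S.tg K Δ
  subset : Δ'.toSet ⊆ Δ.toSet

/-- The edge `(V(Δ), V(Δ'), q(Δ, Δ'))`, where `q` is the position index. -/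
def edgeOf (S : IFS I) (K : Set ℝ) (Δ Δ' : GenInterval) : NbEdge where
  source := S.nbSet K Δ
  target := S.nbSet K Δ'
  label := (Δ'.left - Δ.left) / (Δ.right - Δ.left)

/-- The vertices of the transition graph: all neighbour sets of net intervals. -/
def vertices (S : IFS I) (K : Set ℝ) : Set (Set (ℝ → ℝ)) :=
  {v | ∃ Δ, S.IsNetInterval K Δ ∧ S.nbSet K Δ = v}

/-- The edges of the transition graph. -/
def edges (S : IFS I) (K : Set ℝ) : Set NbEdge :=
  {e | ∃ Δ Δ', S.IsNetInterval K Δ ∧ S.IsChild K Δ Δ' ∧ e = S.edgeOf K Δ Δ'}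

/-- There is a path (a finite non-empty sequence of consecutive edges) from `v` to `w` in the
transition graph. -/
def HasPath (S : IFS I) (K : Set ℝ) : Set (ℝ → ℝ) → Set (ℝ → ℝ) → Prop :=
  Relation.TransGen (fun v w => ∃ e ∈ S.edges K, e.source = v ∧ e.target = w)

/-- `H` is the vertex set of an essential class of the transition graph. -/
structure IsEssentialClass (S : IFS I) (K : Set ℝ) (H : Set (Set (ℝ → ℝ))) : Prop where
  nonempty : H.Nonempty
  subset : H ⊆ S.vertices K
  connected : ∀ v ∈ H, ∀ w ∈ H, S.HasPath K v w
  closed : ∀ v ∈ S.vertices K, ∀ w ∈ H, S.HasPath K w v → v ∈ H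

/-- The edges of the subgraph of the transition graph induced by the vertex set `H`. -/
def inducedEdges (S : IFS I) (K : Set ℝ) (H : Set (Set (ℝ → ℝ))) : Set NbEdge :=
  {e | e ∈ S.edges K ∧ e.source ∈ H ∧ e.target ∈ H}

/-- The infinite path `e` is a symbolic representation of `x`: it is read off a nested sequence of
net intervals which starts with the root `[0,1]` (the only net interval of any generation `> 1`),
passes to a child at each step, and has intersection `{x}`. -/
def IsSymbolicRep (S : IFS I) (K : Set ℝ) (x : ℝ) (e : ℕ → NbEdge) : Prop :=
  ∃ Δ : ℕ → GenInterval,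
    S.IsNetInterval K (Δ 0) ∧ 1 < (Δ 0).gen ∧ (Δ 0).toSet = Set.Icc 0 1 ∧
    (∀ n, S.IsChild K (Δ n) (Δ (n + 1))) ∧
    (⋂ n, (Δ n).toSet) = {x} ∧
    ∀ n, e n = S.edgeOf K (Δ n) (Δ (n + 1))

/-- The set of interior essential points with respect to the essential class with vertex set `H`:
the points of `K` all of whose symbolic representations are eventually in that class. -/
def interiorEssential (S : IFS I) (K : Set ℝ) (H : Set (Set (ℝ → ℝ))) : Set ℝ :=
  {x | x ∈ K ∧ ∀ e, S.IsSymbolicRep K x e → ∃ N, ∀ k ≥ N, e k ∈ S.inducedEdges K H}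

/-- `μ` is the self-similar measure associated with the probability vector `p`. -/
structure IsSelfSimilarMeasure [Fintype I] (S : IFS I) (K : Set ℝ) (p : I → ℝ)
    (μ : MeasureTheory.Measure ℝ) : Prop where
  p_pos : ∀ i, 0 < p i
  p_sum : ∑ i, p i = 1
  isProbabilityMeasure : MeasureTheory.IsProbabilityMeasure μ
  support_eq : μ.support = K
  invariant : ∀ E, MeasurableSet E → μ.real E = ∑ i, p i * μ.real (S.fn i ⁻¹' E)

end

end IFS

namespace IFS

variable {I : Type*}

/-! The heart of the matter is rigidity of an optimal ball. Let U = U(x,t) attain the supremum. The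
maps S_σ ∘ S_τ, with S_τ of generation t meeting U, are pairwise distinct, of generation |r_σ|t, and
meet S_σ(U); so S_σ(U) attains the supremum too, and by maximality no further map of that generation
meets it (`AttainsAt.image_eq`). Hence S_σ(U) carries an exact copy of the cylinder structure of U
in every generation at most t, and a net interval of such a generation inside U is sent by every S_σ
with r_σ > 0 to a net interval with the same neighbour set (`IsEmbedded.affineImage`).

Since such copies fit into any net interval, the neighbour set of an embedded net interval can be
reached from every vertex (`IsEmbedded.hasPath`). This forces exactly one essential class,
consisting of all that such a vertex reaches. A point of K ∩ U has all its net intervals of small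
generation inside U, which makes it interior essential. For a finite cover of all of K ∩ U, net
intervals that stick out of U are put into a slightly shifted ball, which is still optimal.

Neighbour sets determine those of the children, so a path to a given essential vertex v can be
followed inside an embedded net interval; this gives an embedded Δ with neighbour set v. Every
cylinder contains, at bounded relative depth, a subcylinder inside an orientation-preserving copy of
Δ, so the set missed by all copies loses a fixed proportion of mass and is null (`measure_eq_zero`).
The same argument with the images of U handles K_ess. -/

/-- An attractor with convex hull `[0, 1]`. -/
structure IsNormalized (S : IFS I) (K : Set ℝ) : Prop extends S.IsAttractor K where
  zero_mem : (0 : ℝ) ∈ K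
  one_mem : (1 : ℝ) ∈ K
  subset_Icc : K ⊆ Set.Icc 0 1

theorem IsAttractor.isNormalized {S : IFS I} {K : Set ℝ} (hK : S.IsAttractor K)
    (hull : convexHull ℝ K = Set.Icc 0 1) : S.IsNormalized K := by
  have hsub : K ⊆ Set.Icc 0 1 := hull ▸ subset_convexHull ℝ K
  have hle : Set.Icc (0 : ℝ) 1 ⊆ Set.Icc (sInf K) (sSup K) := by
    rw [← hull]
    exact convexHull_min
      (fun x hx => ⟨csInf_le hK.isCompact.bddBelow hx, le_csSup hK.isCompact.bddAbove hx⟩)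
      (convex_Icc _ _)
  have hinf := hK.isCompact.sInf_mem hK.nonempty
  have hsup := hK.isCompact.sSup_mem hK.nonempty
  have h0 : sInf K = 0 :=
    le_antisymm (hle (Set.left_mem_Icc.2 zero_le_one)).1 (hsub hinf).1
  have h1 : sSup K = 1 :=
    le_antisymm (hsub hsup).2 (hle (Set.right_mem_Icc.2 zero_le_one)).2
  exact ⟨hK, h0 ▸ hinf, h1 ▸ hsup, hsub⟩

/-! ### Words, ratios and generations -/

section Words

variable (S : IFS I)

@[simp] theorem ratio_nil : S.ratio [] = 1 := by simp [ratio]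

@[simp] theorem ratio_cons (i : I) (σ : List I) : S.ratio (i :: σ) = S.r i * S.ratio σ := by
  simp [ratio]

@[simp] theorem ratio_append (σ τ : List I) : S.ratio (σ ++ τ) = S.ratio σ * S.ratio τ := by
  simp [ratio]

theorem wordMap_append (σ τ : List I) : S.wordMap (σ ++ τ) = S.wordMap σ ∘ S.wordMap τ := by
  induction σ with
  | nil => rfl
  | cons i σ ih => simp [wordMap, ih, Function.comp_assoc]

theorem wordMap_apply (σ : List I) (x : ℝ) :
    S.wordMap σ x = S.ratio σ * x + S.wordMap σ 0 := by
  induction σ generalizing x with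
  | nil => simp [wordMap]
  | cons i σ ih =>
    simp only [wordMap, Function.comp_apply, fn, ratio_cons]
    rw [ih x]
    ring

theorem ratio_ne_zero (σ : List I) : S.ratio σ ≠ 0 := by
  induction σ with
  | nil => simp
  | cons i σ ih => simpa [ih] using abs_pos.1 (S.r_pos i)

theorem abs_ratio_pos (σ : List I) : 0 < |S.ratio σ| := abs_pos.2 (S.ratio_ne_zero σ)

theorem abs_ratio_le_one (σ : List I) : |S.ratio σ| ≤ 1 := by
  induction σ with
  | nil => simp
  | cons i σ ih =>
    rw [ratio_cons, abs_mul]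
    exact mul_le_one₀ (S.r_lt_one i).le (abs_nonneg _) ih

theorem abs_ratio_append_le (σ τ : List I) : |S.ratio (σ ++ τ)| ≤ |S.ratio σ| := by
  rw [ratio_append, abs_mul]
  exact mul_le_of_le_one_right (abs_nonneg _) (S.abs_ratio_le_one τ)

theorem wordMap_injective (σ : List I) : Function.Injective (S.wordMap σ) := by
  intro x y h
  rw [S.wordMap_apply σ x, S.wordMap_apply σ y] at h
  exact mul_left_cancel₀ (S.ratio_ne_zero σ) (add_right_cancel h)

theorem continuous_wordMap (σ : List I) : Continuous (S.wordMap σ) := by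
  have : S.wordMap σ = fun x => S.ratio σ * x + S.wordMap σ 0 := funext (S.wordMap_apply σ)
  rw [this]
  fun_prop

theorem wordMap_image_ball (σ : List I) (x t : ℝ) :
    S.wordMap σ '' Metric.ball x t = Metric.ball (S.wordMap σ x) (|S.ratio σ| * t) := by
  have hr := S.ratio_ne_zero σ
  ext y
  constructor
  · rintro ⟨z, hz, rfl⟩
    rw [Metric.mem_ball, Real.dist_eq] at *
    rw [S.wordMap_apply σ z, S.wordMap_apply σ x, add_sub_add_right_eq_sub, ← mul_sub, abs_mul]
    exact mul_lt_mul_of_pos_left hz (S.abs_ratio_pos σ)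
  · intro hy
    refine ⟨(y - S.wordMap σ 0) / S.ratio σ, ?_, ?_⟩
    · rw [Metric.mem_ball, Real.dist_eq] at *
      rw [S.wordMap_apply σ x] at hy
      have : y - (S.ratio σ * x + S.wordMap σ 0) =
          S.ratio σ * ((y - S.wordMap σ 0) / S.ratio σ - x) := by
        field_simp; ring
      rw [this, abs_mul] at hy
      exact lt_of_mul_lt_mul_left hy (abs_nonneg _)
    · rw [S.wordMap_apply]
      field_simp
      ring

/-- Different words can give the same map, but the slope of the map, hence the ratio, can be read
off at 0 and 1. This lets generation conditions pass through identities between maps. -/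
theorem abs_ratio_eq_of_comp_eq {a b : ℝ} {σ τ : List I}
    (h : (fun x => a * x + b) ∘ S.wordMap σ = S.wordMap τ) :
    |S.ratio τ| = |a| * |S.ratio σ| := by
  have h0 := congrFun h 0
  have h1 := congrFun h 1
  simp only [Function.comp_apply] at h0 h1
  rw [S.wordMap_apply σ 1, S.wordMap_apply τ 1] at h1
  rw [← abs_mul]
  congr 1
  linarith

theorem exists_neg_of_ratio_neg {σ : List I} (h : S.ratio σ < 0) : ∃ j, S.r j < 0 := by
  by_contra! hj
  induction σ with
  | nil => norm_num at h
  | cons i σ ih =>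
    rw [ratio_cons] at h
    by_cases hσ : S.ratio σ < 0
    · exact ih hσ
    · nlinarith [mul_nonneg (hj i) (not_lt.1 hσ)]

/-- Letters are stripped from the end while the ratio stays below t; the shortest prefix left is of
generation t. -/
theorem exists_prefix_mem_words {t : ℝ} {τ : List I} (h : |S.ratio τ| < t) :
    ∃ σ τ', σ ++ τ' = τ ∧ σ ∈ S.words t := by
  induction τ using List.reverseRecOn with
  | nil => exact ⟨[], [], rfl, h, fun h => absurd rfl h⟩
  | append_singleton τ i ih =>
    by_cases hτ : |S.ratio τ| < t
    · obtain ⟨σ, τ', rfl, hσ⟩ := ih hτ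
      exact ⟨σ, τ' ++ [i], by simp, hσ⟩
    · exact ⟨τ ++ [i], [], by simp, h, fun _ => by simpa using not_lt.1 hτ⟩

theorem append_mem_words_iff {s : ℝ} {σ τ : List I} (hτ : τ ≠ []) :
    σ ++ τ ∈ S.words s ↔
      |S.ratio σ| * |S.ratio τ| < s ∧ s ≤ |S.ratio σ| * |S.ratio τ.dropLast| := by
  simp [words, hτ, List.dropLast_append_of_ne_nil hτ, abs_mul]

theorem nil_mem_words_iff {t : ℝ} : [] ∈ S.words t ↔ 1 < t := by
  simp [words]

theorem words_eq_singleton {t : ℝ} (ht : 1 < t) : S.words t = {[]} := by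
  ext σ
  constructor
  · rintro ⟨-, h⟩
    by_contra hσ
    exact absurd (h hσ) (not_le.2 ((S.abs_ratio_le_one _).trans_lt ht))
  · rintro rfl
    exact S.nil_mem_words_iff.2 ht

theorem endpoint_mem_image {K : Set ℝ} (hK : S.IsNormalized K) {t h : ℝ} (hh : h ∈ S.endpoints t) :
    ∃ σ ∈ S.words t, (h = S.wordMap σ 0 ∨ h = S.wordMap σ 1) ∧ h ∈ S.wordMap σ '' K := by
  obtain ⟨σ, hσ, h'⟩ := hh
  refine ⟨σ, hσ, h', ?_⟩
  rcases h' with rfl | rfl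
  exacts [⟨0, hK.zero_mem, rfl⟩, ⟨1, hK.one_mem, rfl⟩]

theorem endpoints_of_comp {a b t' h : ℝ} {σ τ : List I}
    (hτ : τ ∈ S.words t') (hA : (fun x => a * x + b) ∘ S.wordMap σ = S.wordMap τ)
    (hh : h = S.wordMap σ 0 ∨ h = S.wordMap σ 1) : a * h + b ∈ S.endpoints t' := by
  refine ⟨τ, hτ, ?_⟩
  rw [← hA]
  rcases hh with rfl | rfl
  exacts [Or.inl rfl, Or.inr rfl]

variable [Fintype I]

theorem exists_contraction_bound : ∃ ρ : ℝ, 0 < ρ ∧ ρ < 1 ∧ ∀ i, |S.r i| ≤ ρ := by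
  cases isEmpty_or_nonempty I
  · exact ⟨1 / 2, by norm_num, by norm_num, fun i => isEmptyElim i⟩
  · obtain ⟨i, hi⟩ := Finite.exists_max fun i => |S.r i|
    exact ⟨_, S.r_pos i, S.r_lt_one i, hi⟩

theorem finite_le_abs_ratio {s : ℝ} (hs : 0 < s) : {σ : List I | s ≤ |S.ratio σ|}.Finite := by
  obtain ⟨ρ, h0, h1, hρ⟩ := S.exists_contraction_bound
  obtain ⟨n, hn⟩ := exists_pow_lt_of_lt_one hs h1
  refine (List.finite_length_lt I n).subset fun σ hσ => ?_
  have hle : |S.ratio σ| ≤ ρ ^ σ.length := by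
    clear hσ
    induction σ with
    | nil => simp
    | cons i σ ih =>
      rw [ratio_cons, abs_mul, List.length_cons, pow_succ']
      exact mul_le_mul (hρ i) ih (abs_nonneg _) h0.le
  by_contra hlen
  have := pow_le_pow_of_le_one h0.le h1.le (not_lt.1 hlen)
  exact absurd (hσ.trans (hle.trans this)) (not_le.2 hn)

theorem finite_words {t : ℝ} (ht : 0 < t) : (S.words t).Finite := by
  refine ((Set.finite_singleton ([] : List I)).union (((S.finite_le_abs_ratio ht).prod
    (Set.finite_univ (α := I))).image fun q => q.1 ++ [q.2])).subset fun σ hσ => ?_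
  rcases List.eq_nil_or_concat' σ with rfl | ⟨τ, i, rfl⟩
  · exact Or.inl rfl
  · exact Or.inr ⟨(τ, i), ⟨by simpa using hσ.2 (by simp), trivial⟩, rfl⟩

theorem finite_endpoints {t : ℝ} (ht : 0 < t) : (S.endpoints t).Finite := by
  refine (((S.finite_words ht).image fun σ => S.wordMap σ 0).union
    ((S.finite_words ht).image fun σ => S.wordMap σ 1)).subset ?_
  rintro h ⟨σ, hσ, rfl | rfl⟩
  exacts [Or.inl ⟨σ, hσ, rfl⟩, Or.inr ⟨σ, hσ, rfl⟩]

theorem finite_mapsMeeting {K E : Set ℝ} {t : ℝ} (ht : 0 < t) : (S.mapsMeeting K t E).Finite := by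
  refine ((S.finite_words ht).image S.wordMap).subset ?_
  rintro f ⟨σ, hσ, -, rfl⟩
  exact ⟨σ, hσ, rfl⟩

/-- The set P is kept general because two cases are needed: P = K for covering K by cylinders, and P
= {0, 1} for the persistence of endpoints in finer generations. -/
theorem exists_extension_mem_words {P : Set ℝ} (hP : P ⊆ ⋃ i, S.fn i '' P) {s : ℝ} (hs : 0 < s)
    {σ : List I} (hσ : σ ≠ [] → s ≤ |S.ratio σ.dropLast|) {x : ℝ} (hx : x ∈ S.wordMap σ '' P) :
    ∃ τ ∈ S.words s, x ∈ S.wordMap τ '' P := by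
  obtain ⟨ρ, h0, h1, hρ⟩ := S.exists_contraction_bound
  obtain ⟨n, hn⟩ := exists_pow_lt_of_lt_one hs h1
  have hn' : |S.ratio σ| * ρ ^ n < s :=
    (mul_le_of_le_one_left (by positivity) (S.abs_ratio_le_one σ)).trans_lt hn
  clear hn
  -- Here n bounds the number of letters that may still have to be appended before the ratio drops
  -- below s.
  induction n generalizing σ with
  | zero => exact ⟨σ, ⟨by simpa using hn', hσ⟩, hx⟩
  | succ n ih =>
    by_cases hlt : |S.ratio σ| < s
    · exact ⟨σ, ⟨hlt, hσ⟩, hx⟩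
    obtain ⟨y, hy, rfl⟩ := hx
    obtain ⟨i, z, hz, rfl⟩ := Set.mem_iUnion.1 (hP hy)
    refine ih (σ := σ ++ [i]) (fun _ => by simpa using hlt) ?_ ?_
    · exact ⟨z, hz, by simp [wordMap_append, wordMap]⟩
    · refine lt_of_le_of_lt ?_ hn'
      rw [ratio_append, abs_mul, pow_succ', mul_assoc]
      refine mul_le_mul_of_nonneg_left ?_ (abs_nonneg _)
      simpa using mul_le_mul_of_nonneg_right (hρ i) (by positivity : 0 ≤ ρ ^ n)

end Words

/-! ### The normalized attractor and its small cylinders -/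

namespace IsNormalized

variable {S : IFS I} {K : Set ℝ}

theorem fn_mem (hK : S.IsNormalized K) (i : I) {x : ℝ} (hx : x ∈ K) : S.fn i x ∈ K := by
  rw [hK.eq_iUnion]
  exact Set.mem_iUnion.2 ⟨i, x, hx, rfl⟩

theorem wordMap_mem (hK : S.IsNormalized K) (σ : List I) {x : ℝ} (hx : x ∈ K) :
    S.wordMap σ x ∈ K := by
  induction σ with
  | nil => exact hx
  | cons i σ ih => exact hK.fn_mem i ih

/-- Each S_i is strictly monotone and maps [0,1] into itself, so it can take the extreme value 0 or
1 only at an end of [0,1]. -/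
theorem pair_subset (hK : S.IsNormalized K) : ({0, 1} : Set ℝ) ⊆ ⋃ i, S.fn i '' {0, 1} := by
  intro x hx
  have hxK : x ∈ K := by
    rcases hx with rfl | rfl
    exacts [hK.zero_mem, hK.one_mem]
  rw [hK.eq_iUnion] at hxK
  obtain ⟨i, y, hy, rfl⟩ := Set.mem_iUnion.1 hxK
  refine Set.mem_iUnion.2 ⟨i, y, ?_, rfl⟩
  have hy' := hK.subset_Icc hy
  have h0 := hK.subset_Icc (hK.fn_mem i hK.zero_mem)
  have h1 := hK.subset_Icc (hK.fn_mem i hK.one_mem)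
  simp only [fn, mul_zero, zero_add, mul_one, Set.mem_Icc, Set.mem_insert_iff,
    Set.mem_singleton_iff] at *
  by_contra! hne
  have hy0 : 0 < y := lt_of_le_of_ne hy'.1 (Ne.symm hne.1)
  have hy1 : y < 1 := lt_of_le_of_ne hy'.2 hne.2
  rcases lt_or_gt_of_ne (abs_pos.1 (S.r_pos i)) with hr | hr
  · rcases hx with hx | hx <;> nlinarith
  · rcases hx with hx | hx <;> nlinarith

theorem nonempty_index (hK : S.IsNormalized K) : Nonempty I := by
  obtain ⟨x, hx⟩ := hK.nonempty
  rw [hK.eq_iUnion] at hx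
  exact ⟨(Set.mem_iUnion.1 hx).choose⟩

/-- The images of 0 and 1 under the powers of one S_i are at the pairwise distinct distances
|r_i|^n. -/
theorem infinite (hK : S.IsNormalized K) : K.Infinite := by
  intro hfin
  obtain ⟨i⟩ := hK.nonempty_index
  have hinj : Function.Injective fun n : ℕ => |S.r i| ^ n :=
    (pow_right_strictAnti₀ (S.r_pos i) (S.r_lt_one i)).injective
  refine Set.infinite_of_injective_forall_mem hinj (s := (fun q : ℝ × ℝ => |q.1 - q.2|) '' K ×ˢ K)
    (fun n => ⟨(S.wordMap (List.replicate n i) 1, S.wordMap (List.replicate n i) 0),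
      ⟨hK.wordMap_mem _ hK.one_mem, hK.wordMap_mem _ hK.zero_mem⟩, ?_⟩) ((hfin.prod hfin).image _)
  simp only
  rw [S.wordMap_apply _ 1]
  simp [ratio]

variable [Fintype I]

theorem exists_word (hK : S.IsNormalized K) {s : ℝ} (hs : 0 < s) {x : ℝ} (hx : x ∈ K) :
    ∃ τ ∈ S.words s, x ∈ S.wordMap τ '' K :=
  S.exists_extension_mem_words hK.eq_iUnion.subset hs (σ := []) (fun h => absurd rfl h)
    ⟨x, hx, rfl⟩

theorem endpoints_subset (hK : S.IsNormalized K) {s t : ℝ} (hs : 0 < s) (hst : s ≤ t) :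
    S.endpoints t ⊆ S.endpoints s := by
  rintro h ⟨σ, hσ, hh⟩
  obtain ⟨τ, hτ, y, hy, rfl⟩ := S.exists_extension_mem_words hK.pair_subset hs
    (fun h => hst.trans (hσ.2 h)) (x := h) (by
      rcases hh with rfl | rfl
      exacts [⟨0, by simp, rfl⟩, ⟨1, by simp, rfl⟩])
  refine ⟨τ, hτ, ?_⟩
  rcases hy with rfl | rfl
  exacts [Or.inl rfl, Or.inr rfl]

/-- Every open set meeting `K` contains arbitrarily small images of any bounded interval. -/
theorem exists_image_subset (hK : S.IsNormalized K) {V : Set ℝ} (hV : IsOpen V)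
    (hne : (V ∩ K).Nonempty) (R : ℝ) {η : ℝ} (hη : 0 < η) :
    ∃ σ, |S.ratio σ| < η ∧ S.wordMap σ '' Set.Icc (-R) R ⊆ V := by
  obtain ⟨y, hyV, hyK⟩ := hne
  obtain ⟨δ, hδ, hball⟩ := Metric.isOpen_iff.1 hV y hyV
  -- As K ⊆ [0,1], a point of [-R,R] is within |R| + 1 of a point of K, which explains the scale δ /
  -- (|R| + 1).
  obtain ⟨σ, hσ, k, hk, rfl⟩ :=
    hK.exists_word (s := min η (δ / (|R| + 1))) (lt_min hη (by positivity)) hyK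
  refine ⟨σ, hσ.1.trans_le (min_le_left _ _), ?_⟩
  rintro _ ⟨z, hz, rfl⟩
  apply hball
  have h1 : |S.ratio σ| < δ / (|R| + 1) := hσ.1.trans_le (min_le_right _ _)
  have hk' := hK.subset_Icc hk
  have h2 : |z - k| ≤ |R| + 1 := by
    rw [abs_le]
    constructor <;> linarith [hz.1, hz.2, hk'.1, hk'.2, le_abs_self R]
  rw [Metric.mem_ball, Real.dist_eq, S.wordMap_apply σ z, S.wordMap_apply σ k,
    add_sub_add_right_eq_sub, ← mul_sub, abs_mul]
  calc |S.ratio σ| * |z - k| ≤ |S.ratio σ| * (|R| + 1) :=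
        mul_le_mul_of_nonneg_left h2 (abs_nonneg _)
    _ < δ := (lt_div_iff₀ (by positivity)).1 h1

/-- Neighbour sets are normalized by increasing maps, so copies must preserve orientation. A
negative ratio is corrected by appending one letter of negative ratio, which exists because the
product is negative. -/
theorem exists_image_subset_of_pos (hK : S.IsNormalized K) {V : Set ℝ} (hV : IsOpen V)
    (hne : (V ∩ K).Nonempty) (R : ℝ) {η : ℝ} (hη : 0 < η) :
    ∃ σ, 0 < S.ratio σ ∧ S.ratio σ < η ∧ S.wordMap σ '' Set.Icc (-R) R ⊆ V := by
  -- The radius is enlarged so that it still holds the image of [-R,R] under any one S_j.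
  obtain ⟨σ, hση, hσ⟩ := hK.exists_image_subset hV hne (|R| + ∑ i, |S.d i|) hη
  have hsum : 0 ≤ ∑ i, |S.d i| := Finset.sum_nonneg fun i _ => abs_nonneg _
  rcases lt_or_gt_of_ne (S.ratio_ne_zero σ) with h | h
  · obtain ⟨j, hj⟩ := S.exists_neg_of_ratio_neg h
    refine ⟨σ ++ [j], ?_, ?_, ?_⟩
    · simpa using mul_pos_of_neg_of_neg h hj
    · exact (le_abs_self _).trans_lt ((S.abs_ratio_append_le σ [j]).trans_lt hση)
    · rw [wordMap_append, Set.image_comp]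
      refine (Set.image_mono ?_).trans hσ
      rintro _ ⟨z, hz, rfl⟩
      have hz' : |z| ≤ |R| := by
        rw [abs_le]
        constructor <;> linarith [hz.1, hz.2, le_abs_self R]
      have h1 : |S.d j| ≤ ∑ i, |S.d i| :=
        Finset.single_le_sum (f := fun i => |S.d i|) (fun i _ => abs_nonneg _) (Finset.mem_univ j)
      have h2 : |S.r j * z + S.d j| ≤ |R| + ∑ i, |S.d i| := by
        refine (abs_add_le _ _).trans (add_le_add ?_ h1)
        rw [abs_mul]
        exact (mul_le_of_le_one_left (abs_nonneg _) (S.r_lt_one j).le).trans hz'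
      simpa [wordMap, fn, Set.mem_Icc] using abs_le.1 h2
  · refine ⟨σ, h, (le_abs_self _).trans_lt hση, (Set.image_mono ?_).trans hσ⟩
    apply Set.Icc_subset_Icc <;> linarith [le_abs_self R]

end IsNormalized

end IFS

/-! ### Affine transfer of cylinders between generations -/

/-- The image of a generation-tagged interval under `x ↦ a * x + b`, with its generation scaled
by `a`. -/
noncomputable def GenInterval.affineImage (a b : ℝ) (Δ : GenInterval) : GenInterval where
  gen := a * Δ.gen
  left := a * Δ.left + b
  right := a * Δ.right + b

theorem GenInterval.mem_inner_affineImage {a : ℝ} (ha : 0 < a) (b : ℝ) (Δ : GenInterval) (x : ℝ) :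
    x ∈ Δ.inner ↔ a * x + b ∈ (Δ.affineImage a b).inner := by
  simp [GenInterval.inner, GenInterval.affineImage, ha]

theorem GenInterval.Tinv_affineImage {a : ℝ} (ha : a ≠ 0) (b : ℝ) (Δ : GenInterval) (x : ℝ) :
    (Δ.affineImage a b).Tinv (a * x + b) = Δ.Tinv x := by
  simp only [GenInterval.Tinv, GenInterval.affineImage, add_sub_add_right_eq_sub, ← mul_sub]
  exact mul_div_mul_left _ _ ha

namespace IFS

variable {I : Type*}

/-- Composition with `x ↦ a * x + b` sends the maps of generation `t` meeting `E` to maps of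
generation `t'`. -/
def Transfers (S : IFS I) (K : Set ℝ) (a b t t' : ℝ) (E : Set ℝ) : Prop :=
  ∀ σ ∈ S.words t, (S.wordMap σ '' K ∩ E).Nonempty →
    ∃ τ ∈ S.words t', (fun x => a * x + b) ∘ S.wordMap σ = S.wordMap τ

section Transfer

variable {S : IFS I} {K E F : Set ℝ} {a b s t t' : ℝ}

theorem Transfers.mono (h : S.Transfers K a b t t' E) (hF : F ⊆ E) : S.Transfers K a b t t' F :=
  fun σ hσ hne => h σ hσ (hne.mono (Set.inter_subset_inter_right _ hF))

/-- A transfer at a coarse generation passes to finer ones: cut a word at its prefix of generation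
t, transfer the prefix, and reattach the tail. The bound |a| * s ≤ t' serves the case of an empty
tail. -/
theorem Transfers.of_le (h : S.Transfers K a b t t' E) (hK : S.IsNormalized K) (ha : a ≠ 0)
    (hs : s ≤ t) (hs' : |a| * s ≤ t') : S.Transfers K a b s (|a| * s) E := by
  intro τ hτ hne
  obtain ⟨σ, τ', rfl, hσ⟩ := S.exists_prefix_mem_words (hτ.1.trans_le hs)
  rw [wordMap_append, Set.image_comp] at hne
  have hsub : S.wordMap τ' '' K ⊆ K := by
    rintro _ ⟨x, hx, rfl⟩
    exact hK.wordMap_mem τ' hx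
  obtain ⟨σ', hσ', hcomp⟩ := h σ hσ (hne.mono (Set.inter_subset_inter_left _ (Set.image_mono hsub)))
  have hr := S.abs_ratio_eq_of_comp_eq hcomp
  have ha' : 0 < |a| := abs_pos.2 ha
  refine ⟨σ' ++ τ', ?_, by rw [wordMap_append, wordMap_append, ← hcomp, Function.comp_assoc]⟩
  by_cases hτ' : τ' = []
  · subst hτ'
    simp only [List.append_nil] at hτ ⊢
    exact ⟨hr ▸ mul_lt_mul_of_pos_left hτ.1 ha', fun hne => hs'.trans (hσ'.2 hne)⟩
  · rw [append_mem_words_iff _ hτ'] at hτ ⊢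
    rw [hr, mul_assoc, mul_assoc]
    exact ⟨mul_lt_mul_of_pos_left hτ.1 ha', mul_le_mul_of_nonneg_left hτ.2 ha'.le⟩

theorem comp_wordMap_inverse (ha : a ≠ 0) {f g : ℝ → ℝ} (h : (fun x => a * x + b) ∘ f = g) :
    (fun x => a⁻¹ * x + -(b / a)) ∘ g = f := by
  subst h
  funext x
  simp only [Function.comp_apply]
  field_simp
  ring

theorem image_meets_iff (hEF : ∀ x, x ∈ E ↔ a * x + b ∈ F) {f g : ℝ → ℝ}
    (h : (fun x => a * x + b) ∘ f = g) :
    (f '' K ∩ E).Nonempty ↔ (g '' K ∩ F).Nonempty := by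
  subst h
  constructor
  · rintro ⟨_, ⟨x, hx, rfl⟩, hE⟩
    exact ⟨_, ⟨x, hx, rfl⟩, (hEF _).1 hE⟩
  · rintro ⟨_, ⟨x, hx, rfl⟩, hE⟩
    exact ⟨_, ⟨x, hx, rfl⟩, (hEF _).2 hE⟩

theorem mem_iff_inverse (ha : a ≠ 0) (hEF : ∀ x, x ∈ E ↔ a * x + b ∈ F) (x : ℝ) :
    x ∈ F ↔ a⁻¹ * x + -(b / a) ∈ E := by
  rw [hEF]
  have : a * (a⁻¹ * x + -(b / a)) + b = x := by field_simp; ring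
  rw [this]

end Transfer

/-! ### Net intervals -/

section Net

variable {S : IFS I} {K : Set ℝ}

theorem nbSet_eq_image (Δ : GenInterval) :
    S.nbSet K Δ = (fun f => Δ.Tinv ∘ f) '' S.mapsMeeting K Δ.gen Δ.inner := by
  ext f
  constructor
  · rintro ⟨σ, ⟨h1, h2⟩, rfl⟩
    exact ⟨_, ⟨σ, h1, h2, rfl⟩, rfl⟩
  · rintro ⟨_, ⟨σ, h1, h2, rfl⟩, rfl⟩
    exact ⟨σ, ⟨h1, h2⟩, rfl⟩

theorem toSet_subset_iff {Δ Δ' : GenInterval} (h : Δ'.left < Δ'.right) :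
    Δ'.toSet ⊆ Δ.toSet ↔ Δ.left ≤ Δ'.left ∧ Δ'.right ≤ Δ.right := by
  unfold GenInterval.toSet
  rw [Set.Icc_subset_Icc_iff h.le]

theorem inner_subset {Δ Δ' : GenInterval} (h : Δ'.left < Δ'.right)
    (hsub : Δ'.toSet ⊆ Δ.toSet) : Δ'.inner ⊆ Δ.inner :=
  Set.Ioo_subset_Ioo ((toSet_subset_iff h).1 hsub).1 ((toSet_subset_iff h).1 hsub).2

namespace IsNetInterval

variable {Δ : GenInterval}

/-- A cylinder meeting the interior of a net interval covers that interval. -/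
theorem length_le (hΔ : S.IsNetInterval K Δ) (hK : S.IsNormalized K) {σ : List I}
    (hσ : σ ∈ S.genWords K Δ) : Δ.right - Δ.left ≤ |S.ratio σ| := by
  obtain ⟨hw, _, ⟨k, hk, rfl⟩, hin⟩ := hσ
  have h0 := hΔ.consecutive (S.wordMap σ 0) ⟨σ, hw, Or.inl rfl⟩
  have h1 := hΔ.consecutive (S.wordMap σ 1) ⟨σ, hw, Or.inr rfl⟩
  have hk' := hK.subset_Icc hk
  have hlt := hΔ.lt
  rw [S.wordMap_apply] at h1 hin
  simp only [GenInterval.inner, Set.mem_Ioo, not_and_or, not_lt] at h0 h1 hin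
  have hnn := neg_le_abs (S.ratio σ)
  have hpp := le_abs_self (S.ratio σ)
  rcases lt_or_gt_of_ne (S.ratio_ne_zero σ) with hr | hr
  · have e1 : S.ratio σ * k ≤ 0 := mul_nonpos_of_nonpos_of_nonneg hr.le hk'.1
    have e2 : S.ratio σ ≤ S.ratio σ * k := by nlinarith [hk'.2]
    rcases h0 with h0 | h0 <;> rcases h1 with h1 | h1 <;> linarith [hin.1, hin.2]
  · have e1 : 0 ≤ S.ratio σ * k := mul_nonneg hr.le hk'.1
    have e2 : S.ratio σ * k ≤ S.ratio σ := by nlinarith [hk'.2]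
    rcases h0 with h0 | h0 <;> rcases h1 with h1 | h1 <;> linarith [hin.1, hin.2]

/-- An affine map which matches the cylinders inside a net interval with cylinders of another
generation carries it to a net interval with the same neighbour set. -/
theorem affineImage (hΔ : S.IsNetInterval K Δ) {a b : ℝ} (ha : 0 < a)
    (h : S.Transfers K a b Δ.gen (a * Δ.gen) Δ.inner)
    (h' : S.Transfers K a⁻¹ (-(b / a)) (a * Δ.gen) Δ.gen (Δ.affineImage a b).inner)
    (hl : a * Δ.left + b ∈ S.endpoints (a * Δ.gen))
    (hr : a * Δ.right + b ∈ S.endpoints (a * Δ.gen)) (hK : S.IsNormalized K)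
    (hne : (S.genWords K Δ).Nonempty) :
    S.IsNetInterval K (Δ.affineImage a b) ∧ S.nbSet K (Δ.affineImage a b) = S.nbSet K Δ := by
  have hmem := GenInterval.mem_inner_affineImage ha b Δ
  have hmem' := mem_iff_inverse ha.ne' hmem
  have htw : ∀ σ ∈ S.genWords K Δ, ∃ τ ∈ S.genWords K (Δ.affineImage a b),
      (fun x => a * x + b) ∘ S.wordMap σ = S.wordMap τ := by
    rintro σ ⟨hσ, hσne⟩
    obtain ⟨τ, hτ, hc⟩ := h σ hσ hσne
    exact ⟨τ, ⟨hτ, (image_meets_iff hmem hc).1 hσne⟩, hc⟩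
  refine ⟨⟨mul_pos ha hΔ.gen_pos, ?_, hl, hr, ?_, ?_⟩, ?_⟩
  · simpa [GenInterval.affineImage, ha] using hΔ.lt
  · intro x hx hin
    obtain ⟨τ, hτ, hx', hxK⟩ := S.endpoint_mem_image hK hx
    obtain ⟨σ, hσ, hc⟩ := h' τ hτ ⟨x, hxK, hin⟩
    exact hΔ.consecutive _ (S.endpoints_of_comp hσ hc hx') ((hmem' x).1 hin)
  · obtain ⟨σ, hσ⟩ := hne
    obtain ⟨τ, ⟨-, _, ⟨x, hx, rfl⟩, hin⟩, -⟩ := htw σ hσ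
    exact ⟨_, hin, hK.wordMap_mem _ hx⟩
  · ext f
    constructor
    · rintro ⟨τ, ⟨hτ, hτne⟩, rfl⟩
      obtain ⟨σ, hσ, hc⟩ := h' τ hτ hτne
      refine ⟨σ, ⟨hσ, (image_meets_iff hmem' hc).1 hτne⟩, ?_⟩
      rw [← hc]
      funext x
      simp only [Function.comp_apply]
      rw [← GenInterval.Tinv_affineImage ha.ne' b Δ]
      congr 1
      field_simp
      ring
    · rintro ⟨σ, hσ, rfl⟩
      obtain ⟨τ, hτ, hc⟩ := htw σ hσ
      refine ⟨τ, hτ, ?_⟩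
      rw [← hc]
      funext x
      exact (GenInterval.Tinv_affineImage ha.ne' b Δ _).symm

variable [Fintype I]

theorem genWords_nonempty (hΔ : S.IsNetInterval K Δ) (hK : S.IsNormalized K) :
    (S.genWords K Δ).Nonempty := by
  obtain ⟨x, hin, hx⟩ := hΔ.meets
  obtain ⟨σ, hσ, hxσ⟩ := hK.exists_word hΔ.gen_pos hx
  exact ⟨σ, hσ, x, hxσ, hin⟩

theorem isGreatest_tg (hΔ : S.IsNetInterval K Δ) (hK : S.IsNormalized K) :
    IsGreatest ((fun σ => |S.ratio σ|) '' S.genWords K Δ) (S.tg K Δ) := by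
  have hfin : ((fun σ => |S.ratio σ|) '' S.genWords K Δ).Finite :=
    ((S.finite_words hΔ.gen_pos).subset fun σ hσ => hσ.1).image _
  have hne := (hΔ.genWords_nonempty hK).image fun σ => |S.ratio σ|
  exact ⟨hne.csSup_mem hfin, fun x hx => le_csSup hfin.bddAbove hx⟩

theorem tg_lt_gen (hΔ : S.IsNetInterval K Δ) (hK : S.IsNormalized K) : S.tg K Δ < Δ.gen := by
  obtain ⟨σ, hσ, h⟩ := (hΔ.isGreatest_tg hK).1
  rw [← h]
  exact hσ.1.1

theorem tg_pos (hΔ : S.IsNetInterval K Δ) (hK : S.IsNormalized K) : 0 < S.tg K Δ := by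
  obtain ⟨σ, hσ, h⟩ := (hΔ.isGreatest_tg hK).1
  rw [← h]
  exact S.abs_ratio_pos σ

theorem length_lt_gen (hΔ : S.IsNetInterval K Δ) (hK : S.IsNormalized K) :
    Δ.right - Δ.left < Δ.gen := by
  obtain ⟨σ, hσ⟩ := hΔ.genWords_nonempty hK
  exact (hΔ.length_le hK hσ).trans_lt hσ.1.1

/-- No word meeting the interior is subdivided before the generation drops to `tg`, because all of
their ratios are still below s. -/
theorem mapsMeeting_eq (hΔ : S.IsNetInterval K Δ) (hK : S.IsNormalized K) {s : ℝ}
    (hs : S.tg K Δ < s) (hs' : s ≤ Δ.gen) :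
    S.mapsMeeting K s Δ.inner = S.mapsMeeting K Δ.gen Δ.inner := by
  have hgr : ∀ σ ∈ S.genWords K Δ, |S.ratio σ| < s := fun σ hσ =>
    ((hΔ.isGreatest_tg hK).2 ⟨σ, hσ, rfl⟩).trans_lt hs
  ext f
  constructor
  · rintro ⟨τ, hτ, hne, rfl⟩
    obtain ⟨σ, τ', rfl, hσ⟩ := S.exists_prefix_mem_words (hτ.1.trans_le hs')
    have hσne : (S.wordMap σ '' K ∩ Δ.inner).Nonempty := by
      obtain ⟨_, ⟨x, hx, rfl⟩, hin⟩ := hne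
      exact ⟨_, ⟨S.wordMap τ' x, hK.wordMap_mem _ hx, by rw [wordMap_append]; rfl⟩, hin⟩
    by_cases hτ' : τ' = []
    · subst hτ'
      simp only [List.append_nil] at *
      exact ⟨σ, hσ, hσne, rfl⟩
    · have := hτ.2 (by simp [hτ'])
      rw [List.dropLast_append_of_ne_nil hτ'] at this
      exact absurd (this.trans (S.abs_ratio_append_le σ _)) (not_le.2 (hgr σ ⟨hσ, hσne⟩))
  · rintro ⟨σ, hσ, hne, rfl⟩
    exact ⟨σ, ⟨hgr σ ⟨hσ, hne⟩, fun h => hs'.trans (hσ.2 h)⟩, hne, rfl⟩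

end IsNetInterval

/-- The closed cell of the finite set `E` around a point between two of its elements. -/
theorem exists_consecutive {E : Set ℝ} (hE : E.Finite) {x y : ℝ}
    (hl : ∃ a ∈ E, a ≤ x) (hr : ∃ b ∈ E, y ≤ b) (hno : ∀ z ∈ E, z ∉ Set.Ioo x y) :
    ∃ a ∈ E, ∃ b ∈ E, a ≤ x ∧ y ≤ b ∧ ∀ z ∈ E, z ∉ Set.Ioo a b := by
  obtain ⟨a, ⟨haE, hax⟩, ha⟩ :=
    (hE.subset (Set.inter_subset_left (t := Set.Iic x))).exists_maximal hl
  obtain ⟨b, ⟨hbE, hby⟩, hb⟩ :=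
    (hE.subset (Set.inter_subset_left (t := Set.Ici y))).exists_minimal hr
  refine ⟨a, haE, b, hbE, hax, hby, fun z hz hin => ?_⟩
  by_cases h1 : z ≤ x
  · exact absurd (ha ⟨hz, h1⟩ hin.1.le) (not_le.2 hin.1)
  by_cases h2 : y ≤ z
  · exact absurd (hb ⟨hz, h2⟩ hin.2.le) (not_le.2 hin.2)
  exact hno z hz ⟨not_le.1 h1, not_le.1 h2⟩

variable [Fintype I]

theorem finite_isNetInterval {s : ℝ} (hs : 0 < s) :
    {Δ | S.IsNetInterval K Δ ∧ Δ.gen = s}.Finite := by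
  refine (((S.finite_endpoints hs).prod (S.finite_endpoints hs)).image
    fun q => (⟨s, q.1, q.2⟩ : GenInterval)).subset ?_
  rintro ⟨_, l, r⟩ ⟨hΔ, rfl⟩
  exact ⟨(l, r), ⟨hΔ.left_mem, hΔ.right_mem⟩, rfl⟩

namespace IsNormalized

theorem exists_isNetInterval_of_notMem (hK : S.IsNormalized K) {s : ℝ} (hs : 0 < s) {x : ℝ}
    (hx : x ∈ K) (hxE : x ∉ S.endpoints s) :
    ∃ Δ, S.IsNetInterval K Δ ∧ Δ.gen = s ∧ x ∈ Δ.toSet := by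
  obtain ⟨σ, hσ, k, hk, hkx⟩ := hK.exists_word hs hx
  have h0 : S.wordMap σ 0 ∈ S.endpoints s := ⟨σ, hσ, Or.inl rfl⟩
  have h1 : S.wordMap σ 1 ∈ S.endpoints s := ⟨σ, hσ, Or.inr rfl⟩
  have hk' := hK.subset_Icc hk
  have hex : (∃ a ∈ S.endpoints s, a ≤ x) ∧ ∃ b ∈ S.endpoints s, x ≤ b := by
    have e1 := S.wordMap_apply σ 1
    rw [S.wordMap_apply] at hkx
    rcases lt_or_gt_of_ne (S.ratio_ne_zero σ) with hr | hr
    · exact ⟨⟨_, h1, by nlinarith [hk'.2]⟩, ⟨_, h0, by nlinarith [hk'.1]⟩⟩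
    · exact ⟨⟨_, h0, by nlinarith [hk'.1]⟩, ⟨_, h1, by nlinarith [hk'.2]⟩⟩
  obtain ⟨a, ha, b, hb, hax, hxb, hno⟩ :=
    exists_consecutive (S.finite_endpoints hs) hex.1 hex.2 (by simp)
  have hax' : a < x := lt_of_le_of_ne hax fun h => hxE (h ▸ ha)
  have hxb' : x < b := lt_of_le_of_ne hxb fun h => hxE (h ▸ hb)
  exact ⟨⟨s, a, b⟩, ⟨hs, hax'.trans hxb', ha, hb, hno, x, ⟨hax', hxb'⟩, hx⟩, rfl, hax, hxb⟩

/-- The net intervals of a given generation cover `K`. -/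
theorem exists_isNetInterval (hK : S.IsNormalized K) {s : ℝ} (hs : 0 < s) {x : ℝ} (hx : x ∈ K) :
    ∃ Δ, S.IsNetInterval K Δ ∧ Δ.gen = s ∧ x ∈ Δ.toSet := by
  -- A point of K that is itself an endpoint is approximated by points of K that are not: K is
  -- infinite in every small cylinder, while the endpoints are finitely many. The finite union of
  -- net intervals being closed, the limit is covered.
  have hclosed : IsClosed (⋃ Δ ∈ {Δ | S.IsNetInterval K Δ ∧ Δ.gen = s}, Δ.toSet) :=
    (finite_isNetInterval hs).isClosed_biUnion fun Δ _ => isClosed_Icc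
  have hmem : x ∈ closure (⋃ Δ ∈ {Δ | S.IsNetInterval K Δ ∧ Δ.gen = s}, Δ.toSet) := by
    rw [mem_closure_iff]
    intro V hV hxV
    obtain ⟨σ, -, hσ⟩ := hK.exists_image_subset hV ⟨x, hxV, hx⟩ 1 one_pos
    have hinf := hK.infinite.image (S.wordMap_injective σ).injOn
    obtain ⟨_, ⟨k, hk, rfl⟩, hyE⟩ := (hinf.sdiff (S.finite_endpoints hs)).nonempty
    obtain ⟨Δ, h1, h2, h3⟩ :=
      hK.exists_isNetInterval_of_notMem hs (hK.wordMap_mem σ hk) hyE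
    have hk' := hK.subset_Icc hk
    exact ⟨_, hσ ⟨k, ⟨by linarith [hk'.1], hk'.2⟩, rfl⟩, Set.mem_biUnion ⟨h1, h2⟩ h3⟩
  rw [hclosed.closure_eq] at hmem
  obtain ⟨Δ, ⟨h1, h2⟩, h3⟩ := Set.mem_iUnion₂.1 hmem
  exact ⟨Δ, h1, h2, h3⟩

end IsNormalized

end Net

end IFS

/-! ### Children and paths in the transition graph -/

namespace IFS

variable {I : Type*} {S : IFS I} {K : Set ℝ} {Δ Δ' : GenInterval}

/-- Two vertices of the transition graph are joined by an edge. -/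
def Step (S : IFS I) (K : Set ℝ) (v w : Set (ℝ → ℝ)) : Prop :=
  ∃ e ∈ S.edges K, e.source = v ∧ e.target = w

theorem IsChild.step (hΔ : S.IsNetInterval K Δ) (h : S.IsChild K Δ Δ') :
    S.Step K (S.nbSet K Δ) (S.nbSet K Δ') :=
  ⟨_, ⟨Δ, Δ', hΔ, h, rfl⟩, rfl, rfl⟩

/-- Neighbour sets are equal only if the increasing affine map between the net intervals matches
the cylinders which meet their interiors. -/
theorem IsNetInterval.exists_comp_eq {Θ : GenInterval} (hΔ : S.IsNetInterval K Δ) (hΘ : S.IsNetInterval K Θ)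
    (h : S.nbSet K Θ = S.nbSet K Δ) {c b : ℝ}
    (hc : c = (Δ.right - Δ.left) / (Θ.right - Θ.left)) (hb : b = Δ.left - c * Θ.left) {σ : List I}
    (hσ : σ ∈ S.genWords K Θ) :
    ∃ τ ∈ S.genWords K Δ, (fun x => c * x + b) ∘ S.wordMap σ = S.wordMap τ := by
  have hmem : Θ.Tinv ∘ S.wordMap σ ∈ S.nbSet K Δ := h ▸ ⟨σ, hσ, rfl⟩
  obtain ⟨τ, hτ, hστ⟩ := hmem
  refine ⟨τ, hτ, ?_⟩
  funext x
  have hx := congrFun hστ x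
  have h1 := (sub_pos.2 hΔ.lt).ne'
  have h2 := (sub_pos.2 hΘ.lt).ne'
  simp only [Function.comp_apply, GenInterval.Tinv] at hx ⊢
  rw [div_eq_div_iff h2 h1] at hx
  subst hb hc
  field_simp
  linarith

variable [Fintype I]

namespace IsNetInterval

/-- A net interval whose generation lies between `tg(Δ)` and the generation of `Δ` and which is
contained in `Δ` is `Δ` itself. -/
theorem eq_of_tg_lt (hΔ : S.IsNetInterval K Δ) (hK : S.IsNormalized K)
    (hΔ' : S.IsNetInterval K Δ') (hsub : Δ'.toSet ⊆ Δ.toSet) (hgen : Δ'.gen ≤ Δ.gen)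
    (htg : S.tg K Δ < Δ'.gen) :
    Δ'.left = Δ.left ∧ Δ'.right = Δ.right ∧ S.nbSet K Δ' = S.nbSet K Δ := by
  have hM := hΔ.mapsMeeting_eq hK htg hgen
  have hno : ∀ x ∈ S.endpoints Δ'.gen, x ∉ Δ.inner := by
    intro x hx hin
    obtain ⟨τ, hτ, hx', hxK⟩ := S.endpoint_mem_image hK hx
    have hmem : S.wordMap τ ∈ S.mapsMeeting K Δ'.gen Δ.inner := ⟨τ, hτ, ⟨x, hxK, hin⟩, rfl⟩
    rw [hM] at hmem
    obtain ⟨σ, hσ, -, hστ⟩ := hmem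
    exact hΔ.consecutive x ⟨σ, hσ, hστ ▸ hx'⟩ hin
  have hlt := hΔ'.lt
  have hle := (toSet_subset_iff hlt).1 hsub
  have hl : Δ'.left = Δ.left := by
    by_contra hne
    exact hno _ hΔ'.left_mem ⟨lt_of_le_of_ne hle.1 (Ne.symm hne), hlt.trans_le hle.2⟩
  have hr : Δ'.right = Δ.right := by
    by_contra hne
    exact hno _ hΔ'.right_mem ⟨hle.1.trans_lt hlt, lt_of_le_of_ne hle.2 hne⟩
  refine ⟨hl, hr, ?_⟩
  have hin : Δ'.inner = Δ.inner := by simp [GenInterval.inner, hl, hr]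
  have hT : Δ'.Tinv = Δ.Tinv := by funext x; simp [GenInterval.Tinv, hl, hr]
  rw [nbSet_eq_image, nbSet_eq_image, hin, hT, hM]

/-- Endpoints persist in finer generations. Hence none of generation `tg` lies inside Δ', and the
cell of that generation around Δ' cannot cross the ends of Δ. -/
theorem exists_child (hΔ : S.IsNetInterval K Δ) (hK : S.IsNormalized K)
    (hΔ' : S.IsNetInterval K Δ') (hsub : Δ'.toSet ⊆ Δ.toSet) (hgen : Δ'.gen ≤ S.tg K Δ) :
    ∃ Δ₁, S.IsChild K Δ Δ₁ ∧ Δ'.toSet ⊆ Δ₁.toSet := by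
  have hpos := hΔ.tg_pos hK
  have hE := hK.endpoints_subset hpos (hΔ.tg_lt_gen hK).le
  have hlt := hΔ'.lt
  have hle := (toSet_subset_iff hlt).1 hsub
  obtain ⟨a, ha, b, hb, hal, hrb, hno⟩ := exists_consecutive (S.finite_endpoints hpos)
    ⟨_, hE hΔ.left_mem, hle.1⟩ ⟨_, hE hΔ.right_mem, hle.2⟩
    fun z hz => hΔ'.consecutive z (hK.endpoints_subset hΔ'.gen_pos hgen hz)
  have hab : a < b := hal.trans_lt (hlt.trans_le hrb)
  obtain ⟨x, hx, hxK⟩ := hΔ'.meets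
  refine ⟨⟨S.tg K Δ, a, b⟩, ⟨⟨hpos, hab, ha, hb, hno, x, ?_, hxK⟩, rfl, ?_⟩, ?_⟩
  · exact ⟨hal.trans_lt hx.1, hx.2.trans_le hrb⟩
  · rw [toSet_subset_iff hab]
    constructor
    · by_contra! h
      exact hno _ (hE hΔ.left_mem) ⟨h, hle.1.trans_lt (hlt.trans_le hrb)⟩
    · by_contra! h
      exact hno _ (hE hΔ.right_mem) ⟨hal.trans_lt (hlt.trans_le hle.2), h⟩
  · rw [toSet_subset_iff hlt]
    exact ⟨hal, hrb⟩

/-- The neighbour set of a net interval leads to those of the net intervals of later generations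
which it contains. -/
theorem reflTransGen_step (hK : S.IsNormalized K) (hΔ' : S.IsNetInterval K Δ')
    (hΔ : S.IsNetInterval K Δ) (hsub : Δ'.toSet ⊆ Δ.toSet) (hgen : Δ'.gen ≤ Δ.gen) :
    Relation.ReflTransGen (S.Step K) (S.nbSet K Δ) (S.nbSet K Δ') := by
  have hfin (t : ℝ) : {σ : List I | Δ'.gen ≤ |S.ratio σ| ∧ |S.ratio σ| < t}.Finite :=
    (S.finite_le_abs_ratio hΔ'.gen_pos).subset fun σ hσ => hσ.1
  -- Passing to a child removes from this finite set the words that realize `tg`.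
  induction hn : {σ : List I | Δ'.gen ≤ |S.ratio σ| ∧ |S.ratio σ| < Δ.gen}.ncard
    using Nat.strong_induction_on generalizing Δ with
  | _ n ih =>
    by_cases htg : S.tg K Δ < Δ'.gen
    · rw [(hΔ.eq_of_tg_lt hK hΔ' hsub hgen htg).2.2]
    · obtain ⟨Δ₁, hΔ₁, hsub₁⟩ := hΔ.exists_child hK hΔ' hsub (not_lt.1 htg)
      refine Relation.ReflTransGen.head (hΔ₁.step hΔ)
        (ih _ ?_ hΔ₁.isNetInterval hsub₁ (hΔ₁.gen_eq ▸ not_lt.1 htg) rfl)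
      rw [← hn, hΔ₁.gen_eq]
      obtain ⟨σ, hσ, hσr⟩ := (hΔ.isGreatest_tg hK).1
      simp only at hσr
      refine Set.ncard_lt_ncard ?_ (hfin _)
      refine ⟨fun τ hτ => ⟨hτ.1, hτ.2.trans (hΔ.tg_lt_gen hK)⟩, fun hss => ?_⟩
      have hmem := @hss σ ⟨hσr ▸ not_lt.1 htg, hσ.1.1⟩
      exact hmem.2.ne hσr

/-- A generation at most `tg` guarantees at least one edge, as `HasPath` demands; above `tg` the two
intervals could coincide. -/
theorem hasPath_of_subset (hK : S.IsNormalized K) (hΔ' : S.IsNetInterval K Δ')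
    (hΔ : S.IsNetInterval K Δ) (hsub : Δ'.toSet ⊆ Δ.toSet) (hgen : Δ'.gen ≤ S.tg K Δ) :
    S.HasPath K (S.nbSet K Δ) (S.nbSet K Δ') := by
  obtain ⟨Δ₁, hΔ₁, hsub₁⟩ := hΔ.exists_child hK hΔ' hsub hgen
  exact Relation.TransGen.head' (hΔ₁.step hΔ)
    (reflTransGen_step hK hΔ' hΔ₁.isNetInterval hsub₁ (hΔ₁.gen_eq ▸ hgen))

/-- Exchanging Δ and Θ gives the reverse inequality, so `tg` relative to the diameter depends on the
neighbour set alone. -/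
theorem tg_div_le {Θ : GenInterval} (hΔ : S.IsNetInterval K Δ) (hΘ : S.IsNetInterval K Θ)
    (hK : S.IsNormalized K) (h : S.nbSet K Θ = S.nbSet K Δ) :
    (Δ.right - Δ.left) / (Θ.right - Θ.left) * S.tg K Θ ≤ S.tg K Δ := by
  obtain ⟨σ, hσ, hr⟩ := (hΘ.isGreatest_tg hK).1
  obtain ⟨τ, hτ, hc⟩ := exists_comp_eq hΔ hΘ h rfl rfl hσ
  rw [← hr]
  simp only
  have hpos := div_pos (sub_pos.2 hΔ.lt) (sub_pos.2 hΘ.lt)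
  rw [← abs_of_pos hpos, ← S.abs_ratio_eq_of_comp_eq hc]
  exact (hΔ.isGreatest_tg hK).2 ⟨τ, hτ, rfl⟩

/-- The neighbour set of a net interval determines those of its children. -/
theorem exists_child_of_nbSet_eq {Θ Θ' : GenInterval} (hΔ : S.IsNetInterval K Δ)
    (hΘ : S.IsNetInterval K Θ) (hK : S.IsNormalized K) (h : S.nbSet K Θ = S.nbSet K Δ)
    (hΘ' : S.IsChild K Θ Θ') : ∃ Δ', S.IsChild K Δ Δ' ∧ S.nbSet K Δ' = S.nbSet K Θ' := by
  have hD := sub_pos.2 hΔ.lt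
  have hT := sub_pos.2 hΘ.lt
  obtain ⟨c, hc⟩ : ∃ c, c = (Δ.right - Δ.left) / (Θ.right - Θ.left) := ⟨_, rfl⟩
  obtain ⟨b, hb⟩ : ∃ b, b = Δ.left - c * Θ.left := ⟨_, rfl⟩
  have hc0 : 0 < c := hc ▸ div_pos hD hT
  have hcinv : c⁻¹ = (Θ.right - Θ.left) / (Δ.right - Δ.left) := by rw [hc, inv_div]
  have hleft : c * Θ.left + b = Δ.left := by rw [hb]; ring
  have hright : c * Θ.right + b = Δ.right := by rw [hb, hc]; field_simp; ring
  have htg : c * S.tg K Θ = S.tg K Δ := by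
    refine le_antisymm (hc ▸ tg_div_le hΔ hΘ hK h) ?_
    have := tg_div_le hΘ hΔ hK h.symm
    rw [← hcinv] at this
    rwa [inv_mul_le_iff₀ hc0] at this
  have hmem : ∀ x, x ∈ Θ.inner ↔ c * x + b ∈ Δ.inner := by
    intro x
    simp [GenInterval.inner, ← hleft, ← hright, hc0]
  have hΔle := (hΔ.tg_lt_gen hK).le
  have hΘle := (hΘ.tg_lt_gen hK).le
  have hsubin := inner_subset hΘ'.isNetInterval.lt hΘ'.subset
  have htr : S.Transfers K c b Θ.gen Δ.gen Θ.inner := fun σ hσ hne =>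
    (exists_comp_eq hΔ hΘ h hc hb ⟨hσ, hne⟩).imp fun τ hτ => ⟨hτ.1.1, hτ.2⟩
  have htr' : S.Transfers K c⁻¹ (-(b / c)) Δ.gen Θ.gen Δ.inner := fun σ hσ hne =>
    (exists_comp_eq hΘ hΔ h.symm hcinv (by rw [hb]; field_simp; ring) ⟨hσ, hne⟩).imp
      fun τ hτ => ⟨hτ.1.1, hτ.2⟩
  have key : c * Θ'.gen = S.tg K Δ := by rw [hΘ'.gen_eq, htg]
  have htrs := htr.of_le hK hc0.ne' hΘle (by rwa [abs_of_pos hc0, htg])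
  have hinv : c⁻¹ * S.tg K Δ = S.tg K Θ := by rw [← htg, inv_mul_cancel_left₀ hc0.ne']
  have htrs' := htr'.of_le hK (inv_ne_zero hc0.ne') hΔle
    (by rwa [abs_of_pos (inv_pos.2 hc0), hinv])
  rw [abs_of_pos hc0, htg] at htrs
  rw [abs_of_pos (inv_pos.2 hc0), hinv] at htrs'
  have hEndΔ := hK.endpoints_subset (hΔ.tg_pos hK) hΔle
  have hlt := hΘ'.isNetInterval.lt
  have hle := (toSet_subset_iff hlt).1 hΘ'.subset
  -- The transfer controls only cylinders that meet the interior of Θ; the ends of Θ go to those of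
  -- Δ, which persist as endpoints.
  have hend : ∀ x ∈ S.endpoints Θ'.gen, x ∈ Θ.toSet → c * x + b ∈ S.endpoints (c * Θ'.gen) := by
    intro x hx hxΘ
    rw [key]
    rcases eq_or_lt_of_le hxΘ.1 with h1 | h1
    · rw [← h1, hleft]
      exact hEndΔ hΔ.left_mem
    rcases eq_or_lt_of_le hxΘ.2 with h2 | h2
    · rw [h2, hright]
      exact hEndΔ hΔ.right_mem
    rw [hΘ'.gen_eq] at hx
    obtain ⟨σ, hσ, hx', hxK⟩ := S.endpoint_mem_image hK hx
    obtain ⟨τ, hτ, hcomp⟩ := htrs σ hσ ⟨x, hxK, h1, h2⟩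
    exact S.endpoints_of_comp hτ hcomp hx'
  have himg : (Θ'.affineImage c b).inner ⊆ Δ.inner := by
    refine Set.Ioo_subset_Ioo ?_ ?_
    · rw [← hleft]
      simpa [GenInterval.affineImage, hc0] using hle.1
    · rw [← hright]
      simpa [GenInterval.affineImage, hc0] using hle.2
  have hnet := hΘ'.isNetInterval.affineImage hc0 (b := b)
    (by rw [key, hΘ'.gen_eq]; exact htrs.mono hsubin)
    (by rw [key, hΘ'.gen_eq]; exact htrs'.mono himg)
    (hend _ hΘ'.isNetInterval.left_mem ⟨hle.1, hlt.le.trans hle.2⟩)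
    (hend _ hΘ'.isNetInterval.right_mem ⟨hle.1.trans hlt.le, hle.2⟩) hK
    (hΘ'.isNetInterval.genWords_nonempty hK)
  refine ⟨_, ⟨hnet.1, key, ?_⟩, hnet.2⟩
  rw [toSet_subset_iff hnet.1.lt, ← hleft, ← hright]
  simpa [GenInterval.affineImage, hc0] using hle

/-- A path of the transition graph is realized inside any net interval at its first vertex. -/
theorem exists_of_hasPath (hΔ : S.IsNetInterval K Δ) (hK : S.IsNormalized K)
    {w : Set (ℝ → ℝ)} (h : S.HasPath K (S.nbSet K Δ) w) :
    ∃ Δ', S.IsNetInterval K Δ' ∧ Δ'.toSet ⊆ Δ.toSet ∧ Δ'.gen ≤ Δ.gen ∧ S.nbSet K Δ' = w := by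
  have hstep : ∀ Θ, S.IsNetInterval K Θ → ∀ w, S.Step K (S.nbSet K Θ) w →
      ∃ Δ', S.IsNetInterval K Δ' ∧ Δ'.toSet ⊆ Θ.toSet ∧ Δ'.gen ≤ Θ.gen ∧ S.nbSet K Δ' = w := by
    rintro Θ hΘ w ⟨e, ⟨Θ₁, Θ₂, h₁, h₂, rfl⟩, hs, ht⟩
    obtain ⟨Δ', hΔ', hnb⟩ := exists_child_of_nbSet_eq hΘ h₁ hK hs h₂
    exact ⟨Δ', hΔ'.isNetInterval, hΔ'.subset, hΔ'.gen_eq ▸ (hΘ.tg_lt_gen hK).le, hnb.trans ht⟩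
  unfold HasPath at h
  induction h with
  | single h => exact hstep Δ hΔ _ h
  | tail _ h ih =>
    obtain ⟨Δ₁, h1, h2, h3, rfl⟩ := ih
    obtain ⟨Δ', h1', h2', h3', h4'⟩ := hstep Δ₁ h1 _ h
    exact ⟨Δ', h1', h2'.trans h2, h3'.trans h3, h4'⟩

end IsNetInterval

end IFS

/-! ### Optimal balls and the essential class -/

namespace IFS

variable {I : Type*} {S : IFS I} {K : Set ℝ} {x t : ℝ}

theorem encard_le_wscSup (ht : 0 < t) :
    (S.mapsMeeting K t (Metric.ball x t)).encard ≤ S.wscSup K :=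
  le_iSup_of_le x (le_iSup_of_le t (le_iSup_of_le ht le_rfl))

/-- The ball `U(x,t)` attains the supremum in the weak separation condition. -/
def AttainsAt (S : IFS I) (K : Set ℝ) (x t : ℝ) : Prop :=
  0 < t ∧ (S.mapsMeeting K t (Metric.ball x t)).encard = S.wscSup K

theorem attainsWscSup_iff {U : Set ℝ} :
    S.AttainsWscSup K U ↔ ∃ x t, U = Metric.ball x t ∧ S.AttainsAt K x t := by
  simp only [AttainsWscSup, AttainsAt]
  exact exists_congr fun x => exists_congr fun t => by tauto

/-- A finite supremum in `ℕ∞` is attained; the iterated supremum is first turned into one over a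
single index type. -/
theorem exists_attainsAt (h : S.WeakSeparation K) : ∃ x t, S.AttainsAt K x t := by
  have heq : S.wscSup K =
      ⨆ q : ℝ × Set.Ioi (0 : ℝ), (S.mapsMeeting K q.2 (Metric.ball q.1 q.2)).encard := by
    rw [iSup_prod]
    exact iSup_congr fun x =>
      (iSup_subtype' (p := fun t => t ∈ Set.Ioi (0 : ℝ))
        (f := fun t _ => (S.mapsMeeting K t (Metric.ball x t)).encard))
  have : Nonempty (ℝ × Set.Ioi (0 : ℝ)) := ⟨(0, ⟨1, Set.mem_Ioi.2 one_pos⟩)⟩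
  have hlt : S.wscSup K < ⊤ := h
  rw [heq] at hlt
  obtain ⟨q, hq⟩ := ENat.exists_eq_iSup_of_lt_top hlt
  exact ⟨q.1, q.2, q.2.2, hq.trans heq.symm⟩

/-- If all S_i coincided, K = S_i(K) would have diameter at most |r_i| < 1. -/
theorem IsNormalized.two_le_wscSup (hK : S.IsNormalized K) : 2 ≤ S.wscSup K := by
  refine le_trans ?_ (encard_le_wscSup (S := S) (K := K) (x := 1 / 2) one_pos)
  have hmem : ∀ i, S.fn i ∈ S.mapsMeeting K 1 (Metric.ball (1 / 2) 1) := by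
    intro i
    refine ⟨[i], ⟨by simpa using S.r_lt_one i, by simp⟩, ⟨S.fn i 0, ⟨0, hK.zero_mem, rfl⟩, ?_⟩, rfl⟩
    have := hK.subset_Icc (hK.fn_mem i hK.zero_mem)
    rw [Metric.mem_ball, Real.dist_eq, abs_lt]
    constructor <;> linarith [this.1, this.2]
  suffices hex : ∃ i j, S.fn i ≠ S.fn j by
    obtain ⟨i, j, hij⟩ := hex
    rw [← Set.encard_pair hij]
    exact Set.encard_le_encard (Set.insert_subset (hmem i) (Set.singleton_subset_iff.2 (hmem j)))
  by_contra! hall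
  have h0 := hK.zero_mem
  have h1 := hK.one_mem
  rw [hK.eq_iUnion] at h0 h1
  obtain ⟨i, y, hy, hy0⟩ := Set.mem_iUnion.1 h0
  obtain ⟨j, z, hz, hz1⟩ := Set.mem_iUnion.1 h1
  rw [hall j i] at hz1
  have hy' := hK.subset_Icc hy
  have hz' := hK.subset_Icc hz
  have hr := S.r_lt_one i
  simp only [fn] at hy0 hz1
  have h : S.r i * (z - y) = 1 := by linarith
  have habs : |S.r i| * |z - y| = 1 := by rw [← abs_mul, h, abs_one]
  have : |z - y| ≤ 1 := by
    rw [abs_le]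
    constructor <;> linarith [hy'.1, hy'.2, hz'.1, hz'.2]
  nlinarith [abs_nonneg (S.r i), abs_nonneg (z - y)]

/-- For t > 1 only the identity is counted. The bound keeps the empty word out of generation t; for
it, prepending σ need not give a word of generation |r_σ|t. -/
theorem AttainsAt.le_one (h : S.AttainsAt K x t) (hK : S.IsNormalized K) : t ≤ 1 := by
  by_contra! ht
  have hsub : S.mapsMeeting K t (Metric.ball x t) ⊆ {id} := by
    rintro f ⟨σ, hσ, -, rfl⟩
    rw [S.words_eq_singleton ht] at hσ
    rw [Set.mem_singleton_iff.1 hσ]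
    rfl
  have h1 := Set.encard_le_encard hsub
  rw [h.2, Set.encard_singleton] at h1
  exact absurd (hK.two_le_wscSup.trans h1) (by norm_num)

theorem wordMap_mem_image_iff (σ : List I) {U : Set ℝ} (y : ℝ) :
    y ∈ U ↔ S.ratio σ * y + S.wordMap σ 0 ∈ S.wordMap σ '' U := by
  rw [← S.wordMap_apply, (S.wordMap_injective σ).mem_set_image]

theorem AttainsAt.transfers (h : S.AttainsAt K x t) (hK : S.IsNormalized K) (σ : List I) :
    S.Transfers K (S.ratio σ) (S.wordMap σ 0) t (|S.ratio σ| * t) (Metric.ball x t) := by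
  rintro τ hτ -
  have hne : τ ≠ [] := by
    rintro rfl
    exact absurd (S.nil_mem_words_iff.1 hτ) (not_lt.2 (h.le_one hK))
  have hpos := S.abs_ratio_pos σ
  refine ⟨σ ++ τ, ?_, ?_⟩
  · rw [append_mem_words_iff _ hne]
    exact ⟨mul_lt_mul_of_pos_left hτ.1 hpos, mul_le_mul_of_nonneg_left (hτ.2 hne) hpos.le⟩
  · rw [wordMap_append]
    funext y
    exact (S.wordMap_apply σ _).symm

theorem AttainsAt.image_subset (h : S.AttainsAt K x t) (hK : S.IsNormalized K) (σ : List I) :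
    (fun f => S.wordMap σ ∘ f) '' S.mapsMeeting K t (Metric.ball x t) ⊆
      S.mapsMeeting K (|S.ratio σ| * t) (Metric.ball (S.wordMap σ x) (|S.ratio σ| * t)) := by
  rintro _ ⟨_, ⟨τ, hτ, hne, rfl⟩, rfl⟩
  obtain ⟨τ', hτ', hc⟩ := h.transfers hK σ τ hτ hne
  have hfun : S.wordMap σ = fun y => S.ratio σ * y + S.wordMap σ 0 := funext (S.wordMap_apply σ)
  refine ⟨τ', hτ', ?_, by rw [← hc, ← hfun]⟩
  rw [← wordMap_image_ball]
  exact (image_meets_iff (wordMap_mem_image_iff σ) hc).1 hne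

theorem comp_wordMap_injective (σ : List I) :
    Function.Injective fun f : ℝ → ℝ => S.wordMap σ ∘ f :=
  (S.wordMap_injective σ).comp_left

/-- The image under a cylinder map of a ball attaining the supremum attains it as well. -/
theorem AttainsAt.wordMap (h : S.AttainsAt K x t) (hK : S.IsNormalized K) (σ : List I) :
    S.AttainsAt K (S.wordMap σ x) (|S.ratio σ| * t) := by
  have hpos := mul_pos (S.abs_ratio_pos σ) h.1
  refine ⟨hpos, le_antisymm (encard_le_wscSup hpos) ?_⟩
  rw [← h.2, ← (comp_wordMap_injective (S := S) σ).encard_image]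
  exact Set.encard_le_encard (h.image_subset hK σ)

theorem toSet_affineImage {Δ : GenInterval} {σ : List I} (hσ : 0 < S.ratio σ) :
    (Δ.affineImage (S.ratio σ) (S.wordMap σ 0)).toSet = S.wordMap σ '' Δ.toSet := by
  have hfun : S.wordMap σ = fun y => S.ratio σ * y + S.wordMap σ 0 := funext (S.wordMap_apply σ)
  simp only [GenInterval.toSet, GenInterval.affineImage]
  conv_rhs => rw [hfun]
  rw [Set.image_affine_Icc' hσ]

theorem AttainsAt.inter_nonempty (h : S.AttainsAt K x t) (hK : S.IsNormalized K) :
    (Metric.ball x t ∩ K).Nonempty := by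
  have hne : (S.mapsMeeting K t (Metric.ball x t)).Nonempty := by
    rw [← Set.encard_pos, h.2]
    exact lt_of_lt_of_le (by norm_num) hK.two_le_wscSup
  obtain ⟨_, σ, -, ⟨_, ⟨y, hy, rfl⟩, hyU⟩, -⟩ := hne
  exact ⟨_, hyU, hK.wordMap_mem σ hy⟩

/-- What v reaches is an essential class, and any essential class contains v by closedness, hence
equals it. -/
theorem exists_isEssentialClass {v : Set (ℝ → ℝ)} (hv : v ∈ S.vertices K)
    (h : ∀ u ∈ S.vertices K, S.HasPath K u v) : ∃! H, S.IsEssentialClass K H := by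
  have hvert : ∀ u w, S.HasPath K u w → w ∈ S.vertices K := by
    intro u w hp
    obtain ⟨b, -, e, ⟨Δ, Δ', -, hΔ', rfl⟩, -, rfl⟩ := Relation.TransGen.tail'_iff.1 hp
    exact ⟨Δ', hΔ'.isNetInterval, rfl⟩
  refine ⟨{w | S.HasPath K v w}, ⟨⟨v, h v hv⟩, fun w hw => hvert _ _ hw, ?_, ?_⟩, ?_⟩
  · exact fun w hw w' hw' => (h w (hvert _ _ hw)).trans hw'
  · exact fun w _ w' hw' hp => Relation.TransGen.trans hw' hp
  · intro H hH
    obtain ⟨u, hu⟩ := hH.nonempty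
    have hvH : v ∈ H := hH.closed v hv u hu (h u (hH.subset hu))
    ext w
    exact ⟨fun hw => hH.connected v hvH w hw, fun hw => hH.closed w (hvert _ _ hw) v hvH hw⟩

variable [Fintype I]

/-- Both sides are finite with the maximal cardinality, so the inclusion leaves no room for a map
that does not factor through S_σ. -/
theorem AttainsAt.image_eq (h : S.AttainsAt K x t) (hK : S.IsNormalized K) (σ : List I) :
    (fun f => S.wordMap σ ∘ f) '' S.mapsMeeting K t (Metric.ball x t) =
      S.mapsMeeting K (|S.ratio σ| * t) (Metric.ball (S.wordMap σ x) (|S.ratio σ| * t)) := by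
  have hσ := h.wordMap hK σ
  refine ((S.finite_mapsMeeting hσ.1).subset (h.image_subset hK σ)).eq_of_subset_of_encard_le
    (h.image_subset hK σ) ?_
  rw [hσ.2, (comp_wordMap_injective (S := S) σ).encard_image, h.2]

theorem AttainsAt.transfers_inverse (h : S.AttainsAt K x t) (hK : S.IsNormalized K) (σ : List I) :
    S.Transfers K (S.ratio σ)⁻¹ (-(S.wordMap σ 0 / S.ratio σ)) (|S.ratio σ| * t) t
      (S.wordMap σ '' Metric.ball x t) := by
  intro τ hτ hne
  rw [wordMap_image_ball] at hne
  have hmem : S.wordMap τ ∈ S.mapsMeeting K (|S.ratio σ| * t)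
      (Metric.ball (S.wordMap σ x) (|S.ratio σ| * t)) := ⟨τ, hτ, hne, rfl⟩
  rw [← h.image_eq hK σ] at hmem
  obtain ⟨_, ⟨τ', hτ', -, rfl⟩, hc⟩ := hmem
  have hfun : S.wordMap σ = fun y => S.ratio σ * y + S.wordMap σ 0 := funext (S.wordMap_apply σ)
  refine ⟨τ', hτ', comp_wordMap_inverse (S.ratio_ne_zero σ) ?_⟩
  rw [← hfun]
  exact hc

/-- A net interval lying in a ball which attains the supremum, of generation at most the radius. -/
structure IsEmbedded (S : IFS I) (K : Set ℝ) (x t : ℝ) (Δ : GenInterval) : Prop where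
  attainsAt : S.AttainsAt K x t
  isNetInterval : S.IsNetInterval K Δ
  subset : Δ.toSet ⊆ Metric.ball x t
  gen_le : Δ.gen ≤ t

namespace IsEmbedded

variable {Δ : GenInterval}

/-- Since the closed interval lies in the open ball, the ends of Δ are also covered by the transfer.
-/
theorem affineImage (h : S.IsEmbedded K x t Δ) (hK : S.IsNormalized K) {σ : List I}
    (hσ : 0 < S.ratio σ) :
    S.IsNetInterval K (Δ.affineImage (S.ratio σ) (S.wordMap σ 0)) ∧
      S.nbSet K (Δ.affineImage (S.ratio σ) (S.wordMap σ 0)) = S.nbSet K Δ := by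
  have hgen := h.gen_le
  have htr := (h.attainsAt.transfers hK σ).of_le hK hσ.ne' hgen
    (mul_le_mul_of_nonneg_left hgen (abs_nonneg _))
  have htr' := (h.attainsAt.transfers_inverse hK σ).of_le hK (inv_ne_zero hσ.ne')
    (s := S.ratio σ * Δ.gen) (by rw [abs_of_pos hσ]; exact mul_le_mul_of_nonneg_left hgen hσ.le)
    (by rwa [abs_of_pos (inv_pos.2 hσ), inv_mul_cancel_left₀ hσ.ne'])
  rw [abs_of_pos hσ] at htr
  rw [abs_of_pos (inv_pos.2 hσ), inv_mul_cancel_left₀ hσ.ne'] at htr'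
  have hlt := h.isNetInterval.lt
  have hend : ∀ y ∈ S.endpoints Δ.gen, y ∈ Δ.toSet →
      S.ratio σ * y + S.wordMap σ 0 ∈ S.endpoints (S.ratio σ * Δ.gen) := by
    intro y hy hyΔ
    obtain ⟨τ, hτ, hy', hyK⟩ := S.endpoint_mem_image hK hy
    obtain ⟨τ', hτ', hc⟩ := htr τ hτ ⟨y, hyK, h.subset hyΔ⟩
    exact S.endpoints_of_comp hτ' hc hy'
  have hinner : Δ.inner ⊆ Metric.ball x t := Set.Ioo_subset_Icc_self.trans h.subset
  refine h.isNetInterval.affineImage hσ (htr.mono hinner) (htr'.mono ?_)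
    (hend _ h.isNetInterval.left_mem (Set.left_mem_Icc.2 hlt.le))
    (hend _ h.isNetInterval.right_mem (Set.right_mem_Icc.2 hlt.le)) hK
    (h.isNetInterval.genWords_nonempty hK)
  intro y hy
  rw [mem_iff_inverse hσ.ne' (wordMap_mem_image_iff σ)]
  exact hinner ((mem_iff_inverse hσ.ne' (GenInterval.mem_inner_affineImage hσ _ Δ) y).1 hy)

/-- The neighbour set of an embedded net interval can be reached from every vertex. -/
theorem hasPath (h : S.IsEmbedded K x t Δ) (hK : S.IsNormalized K) {u : Set (ℝ → ℝ)}
    (hu : u ∈ S.vertices K) : S.HasPath K u (S.nbSet K Δ) := by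
  obtain ⟨Θ, hΘ, rfl⟩ := hu
  have hgen := h.isNetInterval.gen_pos
  -- The radius makes [-R,R] contain Δ; the bound on r_σ brings the generation of the copy below
  -- `tg` of Θ.
  obtain ⟨σ, hσ, hση, hσsub⟩ := hK.exists_image_subset_of_pos (V := Θ.inner) isOpen_Ioo hΘ.meets
    (|Δ.left| + |Δ.right|) (div_pos (hΘ.tg_pos hK) hgen)
  obtain ⟨hnet, hnb⟩ := h.affineImage hK hσ
  rw [← hnb]
  refine hnet.hasPath_of_subset hK hΘ ?_ ?_
  · rw [toSet_affineImage hσ]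
    refine Set.Subset.trans (Set.image_mono ?_) (hσsub.trans Set.Ioo_subset_Icc_self)
    refine Set.Icc_subset_Icc ?_ ?_
    · linarith [neg_abs_le Δ.left, abs_nonneg Δ.right]
    · linarith [le_abs_self Δ.right, abs_nonneg Δ.left]
  · exact ((lt_div_iff₀ hgen).1 hση).le

theorem nbSet_mem (h : S.IsEmbedded K x t Δ) (hK : S.IsNormalized K) {H : Set (Set (ℝ → ℝ))}
    (hH : S.IsEssentialClass K H) : S.nbSet K Δ ∈ H := by
  obtain ⟨u, hu⟩ := hH.nonempty
  exact hH.closed _ ⟨Δ, h.isNetInterval, rfl⟩ u hu (h.hasPath hK (hH.subset hu))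

end IsEmbedded

theorem IsNetInterval.toSet_subset_ball {Δ : GenInterval} (hΔ : S.IsNetInterval K Δ)
    (hK : S.IsNormalized K) {y : ℝ} (hy : y ∈ Δ.toSet) (hgen : Δ.gen ≤ t - |y - x|) :
    Δ.toSet ⊆ Metric.ball x t := by
  intro z hz
  have hlen := hΔ.length_lt_gen hK
  have hzy : |z - y| ≤ Δ.right - Δ.left := by
    rw [abs_le]
    constructor <;> linarith [hz.1, hz.2, hy.1, hy.2]
  rw [Metric.mem_ball, Real.dist_eq]
  linarith [abs_sub_le z y x]

theorem AttainsAt.exists_isEmbedded (h : S.AttainsAt K x t) (hK : S.IsNormalized K) :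
    ∃ Δ, S.IsEmbedded K x t Δ := by
  obtain ⟨y, hyU, hyK⟩ := h.inter_nonempty hK
  have hpos : 0 < t - |y - x| := sub_pos.2 hyU
  obtain ⟨Δ, hΔ, hgen, hy⟩ := hK.exists_isNetInterval hpos hyK
  exact ⟨Δ, h, hΔ, hΔ.toSet_subset_ball hK hy hgen.le,
    by rw [hgen]; linarith [abs_nonneg (y - x)]⟩

/-- Balls of the same radius with nearby centres attain the supremum together. -/
theorem AttainsAt.eventually (h : S.AttainsAt K x t) :
    ∀ᶠ ε in nhds (0 : ℝ), S.AttainsAt K (x + ε) t := by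
  have hev : ∀ᶠ ε in nhds (0 : ℝ), ∀ f ∈ S.mapsMeeting K t (Metric.ball x t),
      (f '' K ∩ Metric.ball (x + ε) t).Nonempty := by
    rw [Filter.eventually_all_finite (S.finite_mapsMeeting h.1)]
    rintro f ⟨σ, -, ⟨y, hy, hyU⟩, rfl⟩
    have hcont : Filter.Tendsto (fun ε => dist y (x + ε)) (nhds 0) (nhds (dist y (x + 0))) :=
      (by fun_prop : Continuous fun ε => dist y (x + ε)).tendsto 0
    rw [add_zero] at hcont
    filter_upwards [hcont.eventually_lt_const hyU] with ε hε using ⟨y, hy, hε⟩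
  filter_upwards [hev] with ε hε
  refine ⟨h.1, le_antisymm (encard_le_wscSup h.1) ?_⟩
  rw [← h.2]
  refine Set.encard_le_encard ?_
  rintro f ⟨σ, hσ, hne, rfl⟩
  exact ⟨σ, hσ, hε _ ⟨σ, hσ, hne, rfl⟩, rfl⟩

/-- The net intervals of small generation which meet a ball attaining the supremum are essential. -/
theorem AttainsAt.exists_finite_cover (h : S.AttainsAt K x t) (hK : S.IsNormalized K)
    {H : Set (Set (ℝ → ℝ))} (hH : S.IsEssentialClass K H) :
    ∃ F : Set GenInterval, F.Finite ∧ (∀ Δ ∈ F, S.IsNetInterval K Δ ∧ S.nbSet K Δ ∈ H) ∧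
      K ∩ Metric.ball x t ⊆ ⋃ Δ ∈ F, Δ.toSet := by
  obtain ⟨δ, hδ, hball⟩ := Metric.eventually_nhds_iff.1 h.eventually
  have ht := h.1
  obtain ⟨ε, hε, hεt, hεδ⟩ : ∃ ε, 0 < ε ∧ ε ≤ t / 2 ∧ ε < δ :=
    ⟨min (t / 2) (δ / 2), by positivity, min_le_left _ _,
      (min_le_right _ _).trans_lt (by linarith)⟩
  refine ⟨{Δ | (S.IsNetInterval K Δ ∧ Δ.gen = ε) ∧ S.nbSet K Δ ∈ H},
    (finite_isNetInterval hε).subset fun Δ hΔ => hΔ.1, fun Δ hΔ => ⟨hΔ.1.1, hΔ.2⟩, ?_⟩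
  rintro y ⟨hyK, hyU⟩
  obtain ⟨Δ, hΔ, hgen, hy⟩ := hK.exists_isNetInterval hε hyK
  refine Set.mem_biUnion (x := Δ) ⟨⟨hΔ, hgen⟩, ?_⟩ hy
  have hlen := hΔ.length_lt_gen hK
  rw [hgen] at hlen
  rw [Real.ball_eq_Ioo] at hyU
  -- The centre moves by ε towards the side of y, so that Δ, of length below ε, cannot stick out
  -- there; ε ≤ t / 2 protects the opposite side.
  obtain ⟨c, hc, hsub⟩ : ∃ c, |c| < δ ∧ Δ.toSet ⊆ Metric.ball (x + c) t := by
    rcases le_total x y with hxy | hxy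
    · refine ⟨ε, by rwa [abs_of_pos hε], fun z hz => ?_⟩
      rw [Real.ball_eq_Ioo]
      constructor <;> linarith [hz.1, hz.2, hy.1, hy.2, hyU.1, hyU.2]
    · refine ⟨-ε, by rwa [abs_neg, abs_of_pos hε], fun z hz => ?_⟩
      rw [Real.ball_eq_Ioo]
      constructor <;> linarith [hz.1, hz.2, hy.1, hy.2, hyU.1, hyU.2]
  have hemb : S.IsEmbedded K (x + c) t Δ :=
    ⟨hball (by simpa using hc), hΔ, hsub, by rw [hgen]; linarith⟩
  exact hemb.nbSet_mem hK hH

/-- Generations strictly decrease and, after the first, are values |r_σ|, of which only finitely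
many are at least ε. -/
theorem tendsto_gen (hK : S.IsNormalized K) {Δ : ℕ → GenInterval}
    (h0 : S.IsNetInterval K (Δ 0)) (hΔ : ∀ n, S.IsChild K (Δ n) (Δ (n + 1))) {ε : ℝ}
    (hε : 0 < ε) : ∃ N, ∀ n ≥ N, S.IsNetInterval K (Δ n) ∧ (Δ n).gen < ε := by
  have hnet : ∀ n, S.IsNetInterval K (Δ n) := fun n => by
    cases n with
    | zero => exact h0
    | succ n => exact (hΔ n).isNetInterval
  have hanti : StrictAnti fun n => (Δ n).gen :=
    strictAnti_nat_of_succ_lt fun n => (hΔ n).gen_eq ▸ (hnet n).tg_lt_gen hK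
  suffices hex : ∃ N, (Δ N).gen < ε by
    obtain ⟨N, hN⟩ := hex
    exact ⟨N, fun n hn => ⟨hnet n, (hanti.antitone hn).trans_lt hN⟩⟩
  by_contra! hge
  refine Set.infinite_of_injective_forall_mem
    (hanti.injective.comp (add_left_injective 1)) (fun n => ?_)
    ((S.finite_le_abs_ratio hε).image fun σ => |S.ratio σ|)
  obtain ⟨σ, -, hσ⟩ := ((hnet n).isGreatest_tg hK).1
  have hgen : (Δ (n + 1)).gen = |S.ratio σ| := (hΔ n).gen_eq.trans hσ.symm
  exact ⟨σ, (hge (n + 1)).trans_eq hgen, hgen.symm⟩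

theorem AttainsAt.subset_interiorEssential (h : S.AttainsAt K x t) (hK : S.IsNormalized K)
    {H : Set (Set (ℝ → ℝ))} (hH : S.IsEssentialClass K H) :
    K ∩ Metric.ball x t ⊆ S.interiorEssential K H := by
  rintro y ⟨hyK, hyU⟩
  refine ⟨hyK, ?_⟩
  rintro e ⟨Δ, h0, -, -, hΔ, hinter, he⟩
  have hyU' : 0 < t - |y - x| := sub_pos.2 hyU
  obtain ⟨N, hN⟩ := tendsto_gen hK h0 hΔ hyU'
  have hmem : ∀ n ≥ N, S.nbSet K (Δ n) ∈ H := by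
    intro n hn
    obtain ⟨hnet, hgen⟩ := hN n hn
    have hy : y ∈ (Δ n).toSet := by
      have : y ∈ ⋂ n, (Δ n).toSet := hinter ▸ Set.mem_singleton y
      exact Set.mem_iInter.1 this n
    have hemb : S.IsEmbedded K x t (Δ n) :=
      ⟨h, hnet, hnet.toSet_subset_ball hK hy hgen.le, by linarith [abs_nonneg (y - x)]⟩
    exact hemb.nbSet_mem hK hH
  refine ⟨N, fun k hk => ?_⟩
  have hnet := (hN k hk).1
  rw [he k]
  exact ⟨⟨Δ k, Δ (k + 1), hnet, hΔ k, rfl⟩, hmem k hk, hmem (k + 1) (by omega)⟩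

end IFS

/-! ### Null sets of self-similar measures -/

namespace IFS

open MeasureTheory

variable {I : Type*} [Fintype I] {S : IFS I} {K : Set ℝ} {p : I → ℝ} {μ : Measure ℝ}

namespace IsSelfSimilarMeasure

theorem measure_compl (h : S.IsSelfSimilarMeasure K p μ) : μ Kᶜ = 0 := by
  rw [← h.support_eq]
  exact Measure.measure_compl_support

/-- Unrolling invariance along ω, the cylinder of ω contributes nothing, and the remaining weight 1
- p_ω is charged at most m. -/
theorem le_one_sub_mul (h : S.IsSelfSimilarMeasure K p μ) {E : Set ℝ} (hE : MeasurableSet E)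
    {m : ℝ} (hm : ∀ σ, μ.real (S.wordMap σ ⁻¹' E) ≤ m) (ω : List I)
    (hω : μ.real (S.wordMap ω ⁻¹' E) = 0) : μ.real E ≤ (1 - (ω.map p).prod) * m := by
  classical
  induction ω generalizing E with
  | nil =>
    have : μ.real E = 0 := hω
    simp [this]
  | cons i ω ih =>
    have hi : μ.real (S.fn i ⁻¹' E) ≤ (1 - (ω.map p).prod) * m := by
      refine ih ((S.continuous_wordMap [i]).measurable hE) (fun σ => ?_) hω
      exact hm (i :: σ)
    rw [h.invariant E hE, ← Finset.add_sum_erase _ _ (Finset.mem_univ i)]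
    have hsum := Finset.add_sum_erase _ p (Finset.mem_univ i)
    rw [h.p_sum] at hsum
    have h1 : p i * μ.real (S.fn i ⁻¹' E) ≤ p i * ((1 - (ω.map p).prod) * m) :=
      mul_le_mul_of_nonneg_left hi (h.p_pos i).le
    have h2 : ∑ j ∈ Finset.univ.erase i, p j * μ.real (S.fn j ⁻¹' E) ≤
        (∑ j ∈ Finset.univ.erase i, p j) * m := by
      rw [Finset.sum_mul]
      exact Finset.sum_le_sum fun j _ => mul_le_mul_of_nonneg_left (hm [j]) (h.p_pos j).le
    rw [List.map_cons, List.prod_cons]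
    have h3 : ∑ j ∈ Finset.univ.erase i, p j = 1 - p i := by linarith
    rw [h3] at h2
    linarith

/-- A Borel set is null if it is disjoint from a cylinder of bounded relative depth inside every
cylinder. -/
theorem measure_eq_zero (h : S.IsSelfSimilarMeasure K p μ) {G : Set ℝ} (hG : MeasurableSet G)
    {c : ℝ} (hc : 0 < c)
    (hdisj : ∀ σ, ∃ ω : List I, c ≤ (ω.map p).prod ∧ ∀ x ∈ K, S.wordMap σ (S.wordMap ω x) ∉ G) :
    μ G = 0 := by
  have := h.isProbabilityMeasure
  have hbdd : BddAbove (Set.range fun σ : List I => μ.real (S.wordMap σ ⁻¹' G)) :=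
    ⟨1, by rintro _ ⟨σ, rfl⟩; exact measureReal_le_one⟩
  -- The supremum over all cylinders is what closes the estimate: it yields m ≤ (1 - c) * m.
  obtain ⟨m, hmdef⟩ : ∃ m, m = ⨆ σ : List I, μ.real (S.wordMap σ ⁻¹' G) := ⟨_, rfl⟩
  have hm : ∀ σ, μ.real (S.wordMap σ ⁻¹' G) ≤ m := fun σ => hmdef ▸ le_ciSup hbdd σ
  have hm0 : 0 ≤ m := measureReal_nonneg.trans (hm [])
  have hle : m ≤ (1 - c) * m := by
    conv_lhs => rw [hmdef]
    refine ciSup_le fun σ => ?_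
    obtain ⟨ω, hω, hd⟩ := hdisj σ
    refine (h.le_one_sub_mul ((S.continuous_wordMap σ).measurable hG) (m := m) ?_ ω ?_).trans
      (mul_le_mul_of_nonneg_right (by linarith) hm0)
    · intro τ
      rw [← Set.preimage_comp, ← wordMap_append]
      exact hm _
    · rw [measureReal_def, measure_mono_null (fun x hx => ?_) h.measure_compl, ENNReal.toReal_zero]
      exact fun hxK => hd x hxK hx
  have hz : m = 0 := by nlinarith
  have hG0 : μ.real G = 0 := le_antisymm (hz ▸ hm []) measureReal_nonneg
  exact (measureReal_eq_zero_iff).1 hG0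

theorem prod_pos (h : S.IsSelfSimilarMeasure K p μ) (ω : List I) : 0 < (ω.map p).prod :=
  List.prod_pos (by simpa using fun i _ => h.p_pos i)

theorem measure_compl_iUnion_ball (h : S.IsSelfSimilarMeasure K p μ) (hK : S.IsNormalized K)
    {x t : ℝ} (hne : (Metric.ball x t ∩ K).Nonempty) :
    μ (⋃ σ, S.wordMap σ '' Metric.ball x t)ᶜ = 0 := by
  obtain ⟨ω, -, hω⟩ := hK.exists_image_subset Metric.isOpen_ball hne 1 one_pos
  refine h.measure_eq_zero ?_ (h.prod_pos ω) fun σ => ⟨ω, le_rfl, fun y hy hG => ?_⟩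
  · refine (isOpen_iUnion fun σ => ?_).measurableSet.compl
    rw [wordMap_image_ball]
    exact Metric.isOpen_ball
  · have hy' := hK.subset_Icc hy
    exact hG (Set.mem_iUnion.2 ⟨σ, _, hω ⟨y, ⟨by linarith [hy'.1], hy'.2⟩, rfl⟩, rfl⟩)

theorem measure_diff_interiorEssential (h : S.IsSelfSimilarMeasure K p μ)
    (hK : S.IsNormalized K) {x t : ℝ} (hx : S.AttainsAt K x t) {H : Set (Set (ℝ → ℝ))}
    (hH : S.IsEssentialClass K H) : μ (K \ S.interiorEssential K H) = 0 := by
  refine measure_mono_null ?_ (h.measure_compl_iUnion_ball hK (hx.inter_nonempty hK))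
  rintro y ⟨hyK, hy⟩ hmem
  obtain ⟨σ, hσ⟩ := Set.mem_iUnion.1 hmem
  rw [wordMap_image_ball] at hσ
  exact hy ((hx.wordMap hK σ).subset_interiorEssential hK hH ⟨hyK, hσ⟩)

/-- Almost every point lies in an orientation-preserving image of a given net interval. -/
theorem measure_compl_iUnion_toSet (h : S.IsSelfSimilarMeasure K p μ) (hK : S.IsNormalized K)
    {Δ : GenInterval} (hΔ : S.IsNetInterval K Δ) :
    μ (⋃ σ ∈ {σ | 0 < S.ratio σ}, S.wordMap σ '' Δ.toSet)ᶜ = 0 := by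
  obtain ⟨i⟩ := hK.nonempty_index
  have : Nonempty I := ⟨i⟩
  obtain ⟨ω, -, hω⟩ := hK.exists_image_subset (V := Δ.inner) isOpen_Ioo hΔ.meets 1 one_pos
  obtain ⟨k, hk⟩ := Finite.exists_min p
  have hω' : ∀ y ∈ K, S.wordMap ω y ∈ Δ.toSet := fun y hy =>
    Set.Ioo_subset_Icc_self (hω ⟨y, ⟨by linarith [(hK.subset_Icc hy).1], (hK.subset_Icc hy).2⟩, rfl⟩)
  have hP := h.prod_pos ω
  have hk1 : p k ≤ 1 := by
    rw [← h.p_sum]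
    exact Finset.single_le_sum (fun i _ => (h.p_pos i).le) (Finset.mem_univ k)
  -- The factor p k, the least weight, pays for the letter that restores orientation when r_σ < 0.
  refine h.measure_eq_zero ?_ (mul_pos (h.p_pos k) hP) fun σ => ?_
  · refine (MeasurableSet.biUnion (Set.to_countable _) fun σ _ => ?_).compl
    exact (isCompact_Icc.image (S.continuous_wordMap σ)).isClosed.measurableSet
  · rcases lt_or_gt_of_ne (S.ratio_ne_zero σ) with hσ | hσ
    · obtain ⟨j, hj⟩ := S.exists_neg_of_ratio_neg hσ
      refine ⟨j :: ω, ?_, fun y hy hG => hG ?_⟩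
      · rw [List.map_cons, List.prod_cons]
        exact mul_le_mul_of_nonneg_right (hk j) hP.le
      · refine Set.mem_biUnion (x := σ ++ [j]) ?_ ⟨S.wordMap ω y, hω' y hy, ?_⟩
        · simpa using mul_pos_of_neg_of_neg hσ hj
        · rw [wordMap_append]
          rfl
    · exact ⟨ω, mul_le_of_le_one_left hP.le hk1, fun y hy hG => hG
        (Set.mem_biUnion (x := σ) hσ ⟨_, hω' y hy, rfl⟩)⟩

theorem measure_diff_iUnion_nbSet (h : S.IsSelfSimilarMeasure K p μ)
    (hK : S.IsNormalized K) {x t : ℝ} (hx : S.AttainsAt K x t) {H : Set (Set (ℝ → ℝ))}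
    (hH : S.IsEssentialClass K H) {v : Set (ℝ → ℝ)} (hv : v ∈ H) :
    μ (K \ ⋃ Δ ∈ {Δ | S.IsNetInterval K Δ ∧ S.nbSet K Δ = v}, Δ.toSet ∩ K) = 0 := by
  obtain ⟨Θ, hΘ⟩ := hx.exists_isEmbedded hK
  obtain ⟨Δ, hΔ, hsub, hgen, rfl⟩ := hΘ.isNetInterval.exists_of_hasPath hK
    (hH.connected _ (hΘ.nbSet_mem hK hH) v hv)
  have hemb : S.IsEmbedded K x t Δ := ⟨hx, hΔ, hsub.trans hΘ.subset, hgen.trans hΘ.gen_le⟩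
  refine measure_mono_null ?_ (h.measure_compl_iUnion_toSet hK hΔ)
  rintro y ⟨hyK, hy⟩ hmem
  obtain ⟨σ, hσ, hyσ⟩ := Set.mem_iUnion₂.1 hmem
  rw [← toSet_affineImage hσ] at hyσ
  exact hy (Set.mem_biUnion (hemb.affineImage hK hσ) ⟨hyσ, hyK⟩)

end IsSelfSimilarMeasure

end IFS

theorem theoremt {I : Type*} [Fintype I] (S : IFS I) (K : Set ℝ)
    (hK : S.IsAttractor K) (hull : convexHull ℝ K = Set.Icc 0 1)
    (hwsc : S.WeakSeparation K) :
    (∃! H, S.IsEssentialClass K H) ∧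
    ∀ H, S.IsEssentialClass K H →
      (∀ U, S.AttainsWscSup K U →
        (∀ σ : List I, S.AttainsWscSup K (S.wordMap σ '' U)) ∧
        (∃ F : Set GenInterval, F.Finite ∧
          (∀ Δ ∈ F, S.IsNetInterval K Δ ∧ S.nbSet K Δ ∈ H) ∧
          K ∩ U ⊆ ⋃ Δ ∈ F, Δ.toSet) ∧
        K ∩ U ⊆ S.interiorEssential K H) ∧
      (∀ (p : I → ℝ) (μ : MeasureTheory.Measure ℝ), S.IsSelfSimilarMeasure K p μ →
        (∀ v ∈ H,
          μ (K \ ⋃ Δ ∈ {Δ | S.IsNetInterval K Δ ∧ S.nbSet K Δ = v}, Δ.toSet ∩ K) = 0) ∧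
        μ (K \ S.interiorEssential K H) = 0) := by
  have hN := hK.isNormalized hull
  obtain ⟨x, t, hx⟩ := IFS.exists_attainsAt hwsc
  refine ⟨?_, fun H hH => ⟨fun U hU => ?_, fun p μ hμ => ?_⟩⟩
  · obtain ⟨Δ, hΔ⟩ := hx.exists_isEmbedded hN
    exact IFS.exists_isEssentialClass ⟨Δ, hΔ.isNetInterval, rfl⟩ fun u hu => hΔ.hasPath hN hu
  · obtain ⟨y, s, rfl, hy⟩ := IFS.attainsWscSup_iff.1 hU
    refine ⟨fun σ => IFS.attainsWscSup_iff.2 ⟨_, _, S.wordMap_image_ball σ y s, hy.wordMap hN σ⟩,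
      hy.exists_finite_cover hN hH, hy.subset_interiorEssential hN hH⟩
  · exact ⟨fun v hv => hμ.measure_diff_iUnion_nbSet hN hx hH hv,
      hμ.measure_diff_interiorEssential hN hx hH⟩
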